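/- There is a universal constant $A>0$ with the following property. Fix constants $K,\delta,L,\alpha_{\min}>0$. For every sample size $n$ let $d=d_n\ge 1$ be a dimension, $m=m_n\in\{1,\dots,d\}$, and let $X=(X_1,\dots,X_d)^T$ be a random vector in $\mathbb R^d$ (whose law may depend on $n$) with $\mathbb E X=0$, covariance matrix $\Sigma_X$ with $\lambda_{\min}(\Sigma_X)\ge\delta$, and $\max_{j}\|X_j\|_{\psi_2}\le K$, where $\|Z\|_{\psi_2}=\sup_{p\ge1}p^{-1/2}(\mathbb E|Z|^p)^{1/p}$. Put $\Omega^*=\Sigma_X^{-1}$, $\beta^*=\Omega^*_{*m}$, $v^*=\Omega^*_{*1}$, $\theta^*=\Omega^*_{1m}$, $s=\|\beta^*\|_0$, $s_v=\|v^*\|_0$ and $x^{\otimes2}=xx^T$. Assume $\|\beta^*\|_1\le L$, $\|v^*\|_1\le L$ and $$\Delta:=\operatorname{Var}(v^{*T}X^{\otimes2}\beta^*)\ \ge\ \alpha_{\min}\|\beta^*\|_2^2\|v^*\|_2^2$$ for all $n$, and that, as $n\to\infty$, $$\max(s_v^2,s^2)\,\frac{\log d\,\log(nd)}{n}=o(1),\qquad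 \frac{(s_vs)^k}{n^{k-1}}=o(1)\ \text{ for some real } k>2,$$ $$\operatorname{Var}\big((v^{*T}X^{\otimes2}\beta^*)^2\big)=o(n),\qquad \mathbb E(v^{*T}X^{\otimes2}\beta^*)^2=O(1).$$ Let $\lambda\asymp\sqrt{\log d/n}$ and $\lambda'\asymp\sqrt{\log d/n}$ be such that, for all large $n$, $\lambda\ge AK^2\|\beta^*\|_1\sqrt{\log d/n}$ and $\lambda'\ge AK^2\|v^*\|_1\sqrt{\log d/n}$. Let $X^{(1)},\dots,X^{(n)}$ be i.i.d. copies of $X$, $\Sigma_n=n^{-1}\sum_{i=1}^n (X^{(i)})^{\otimes2}$, and let $\hat\beta,\hat v$ be random vectors that, almost surely, whenever the respective program is feasible, solve $$\hat\beta\in\operatorname{argmin}\{\|\beta\|_1:\|\Sigma_n\beta-e_m\|_\infty\le\lambda\},\qquad \hat v\in\operatorname{argmin}\{\|v\|_1:\|v^T\Sigma_n-e_1^T\|_\infty\le\lambda'\}$$ (any measurable choice of minimizers; arbitrary where infeasible). Define $$\tilde\theta=\hat\beta_1-\frac{\hat v^T(\Sigma_n\hat\beta-e_m)}{\hat v^T\Sigma_{n,*1}},\qquad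 \hat\Delta=\frac1n\sum_{i=1}^n\big(\hat v^T((X^{(i)})^{\otimes2}-\Sigma_n)\hat\beta\big)^2,\qquad \hat U_n=\hat\Delta^{-1/2}n^{1/2}(\tilde\theta-\theta^*).$$ Then for every $t\in\mathbb R$, $$\lim_{n\to\infty}\big|\mathbb P(\hat U_n\le t)-\Phi(t)\big|=0,$$ where $\Phi$ is the standard normal distribution function. -/

import Mathlib

open MeasureTheory ProbabilityTheory Filter Asymptotics Matrix
open scoped Topology ENNReal

noncomputable section

namespace Clime

/-- The norm `‖X‖_{ψ_ℓ} = sup_{p ≥ 1} p ^ (-1/ℓ) (E |X| ^ p) ^ (1/p)`, with values in `[0, ∞]`. -/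
def psiNorm {Ω : Type*} [MeasurableSpace Ω] (l : ℝ) (X : Ω → ℝ) (P : Measure Ω) : ℝ≥0∞ :=
  ⨆ p : {p : ℝ // 1 ≤ p},
    ENNReal.ofReal ((p : ℝ) ^ (-1 / l)) * eLpNorm X (ENNReal.ofReal (p : ℝ)) P

/-- `‖v‖₀`, the number of nonzero coordinates. -/
def l0 {d : ℕ} (v : Fin d → ℝ) : ℕ := {j | v j ≠ 0}.ncard

/-- `‖v‖₁`. -/
def l1 {d : ℕ} (v : Fin d → ℝ) : ℝ := ∑ j, |v j|

/-- `‖v‖₂`. -/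
def l2 {d : ℕ} (v : Fin d → ℝ) : ℝ := √(∑ j, v j ^ 2)

/-- The coordinate vector `e_j`. -/
def unitVec {d : ℕ} (j : Fin d) : Fin d → ℝ := Pi.single j 1

/-- `x^{⊗2} = x xᵀ`. -/
def outer {d : ℕ} (x : Fin d → ℝ) : Matrix (Fin d) (Fin d) ℝ := vecMulVec x x

/-- `vᵀ M b`. -/
def bilin {d : ℕ} (v : Fin d → ℝ) (M : Matrix (Fin d) (Fin d) ℝ) (b : Fin d → ℝ) : ℝ :=
  v ⬝ᵥ (M *ᵥ b)

section Population

variable {d : ℕ} (μ : Measure (Fin d → ℝ))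

/-- The covariance matrix `Σ_X` of a random vector with law `μ`. -/
def popCov : Matrix (Fin d) (Fin d) ℝ :=
  Matrix.of fun j k => covariance (fun x : Fin d → ℝ => x j) (fun x => x k) μ

/-- The precision matrix `Ω* = Σ_X⁻¹`. -/
def precision : Matrix (Fin d) (Fin d) ℝ := (popCov μ)⁻¹

/-- The `j`-th column `Ω*_{*j}` of the precision matrix. -/
def precisionCol (j : Fin d) : Fin d → ℝ := fun i => precision μ i j

/-- `Δ = Var (vᵀ X^{⊗2} b)` for `X` with law `μ`. -/
def popDelta (v b : Fin d → ℝ) : ℝ := variance (fun x => bilin v (outer x) b) μ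

end Population

section Sample

variable {n d : ℕ} (x : Fin n → Fin d → ℝ)

/-- The (uncentred) sample covariance `Σ_n = n⁻¹ ∑ i, x_i^{⊗2}`. -/
def sampleCov : Matrix (Fin d) (Fin d) ℝ := (n : ℝ)⁻¹ • ∑ i, outer (x i)

/-- The vectors `b` with `‖Σ_n b - e_m‖_∞ ≤ lam` (the norm on `Fin d → ℝ` is the sup norm). -/
def betaFeasible (m : Fin d) (lam : ℝ) : Set (Fin d → ℝ) :=
  {b | ‖sampleCov x *ᵥ b - unitVec m‖ ≤ lam}

/-- The vectors `v` with `‖vᵀ Σ_n - e_1‖_∞ ≤ lam'`. -/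
def vFeasible [NeZero d] (lam' : ℝ) : Set (Fin d → ℝ) :=
  {v | ‖v ᵥ* sampleCov x - unitVec 0‖ ≤ lam'}

/-- `b` solves `argmin ‖·‖₁` over the set `F`; no condition if `F` is empty, since
the program then has no solution. -/
def IsL1Solution (F : Set (Fin d → ℝ)) (b : Fin d → ℝ) : Prop :=
  F.Nonempty → b ∈ F ∧ IsMinOn l1 F b

/-- The one-step estimator
`b_1 - vᵀ (Σ_n b - e_m) / (vᵀ Σ_{n,*1})`; the first coordinate has index `0`. -/
def thetaTilde [NeZero d] (m : Fin d) (v b : Fin d → ℝ) : ℝ :=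
  b 0 - (v ⬝ᵥ (sampleCov x *ᵥ b - unitVec m)) / (v ⬝ᵥ fun i => sampleCov x i 0)

/-- The variance estimator `n⁻¹ ∑ i, (vᵀ (x_i^{⊗2} - Σ_n) b)²`. -/
def deltaHat (v b : Fin d → ℝ) : ℝ :=
  (n : ℝ)⁻¹ * ∑ i, bilin v (outer (x i) - sampleCov x) b ^ 2

/-- The studentized estimator `Δ̂^{-1/2} n^{1/2} (θ̃ - θ)`. -/
def studentized [NeZero d] (m : Fin d) (v b : Fin d → ℝ) (θ : ℝ) : ℝ :=
  √(n : ℝ) * (thetaTilde x m v b - θ) / √(deltaHat x v b)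

end Sample

/-- The rate `√(log d / n)`. -/
def rate (n d : ℕ) : ℝ := √(Real.log d / n)

end Clime

end

namespace Clime

/-! ### Sub-Gaussian moments and exponential moments of products. -/

section Moments

variable {Ω : Type*} [MeasurableSpace Ω] {P : Measure Ω}

/-! The one-step correction cancels the first-order effect of the error of β̂. With c = v̂ᵀΣ_{n,*1},
the quantity c(θ̃ - θ*) equals -v*ᵀ(Σ_n β* - e_m) plus terms that are products of two small factors
(`thetaTilde_expansion`). Those products have order max(s, s_v) log d / n up to constants, hence are
o(n^{-1/2}). Since v*ᵀ Σ_X β* = θ*, the leading term is minus the average of the centred i.i.d.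
variables v*ᵀX^{⊗2}β* - θ*. The ℓ₁ and ψ₂ bounds give them bounded fourth moments, and Δ is bounded
below because the diagonal of Ω* is at least 1/(2K²). A characteristic-function CLT for triangular
arrays (`tendsto_measureReal_sum_le`) applies, and consistency of Δ̂ (`abs_deltaHat_sub_le`) with a
Slutsky argument (`tendsto_measureReal_le_of_slutsky`) finishes.

The ℓ₁ errors come from a restricted eigenvalue bound (`mul_l1_le_of_cone`): when the target is
feasible, minimality puts the error in a cone, where Σ_n inherits half the eigenvalue bound of Σ_X.

The delicate point is that d need not tend to infinity. At the level prescribed for λ, feasibility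
of the target is only guaranteed with probability about 1 - 2/d. So, for a given tolerance, a
threshold D is fixed. If d > D, the exceptional probability is at most 2/D. If d ≤ D, Σ_n is
invertible with high probability, the programs are feasible anyway, and the full index set serves as
support at the cost of a factor D (`l1_error_le_of_good`). The entrywise error of Σ_n is measured at
the rate √((log d + 1)/n), which stays meaningful when log d = 0. -/

lemma eLpNorm_le_of_psiNorm_le {X : Ω → ℝ} {K : ℝ} (hK : 0 ≤ K)
    (h : psiNorm 2 X P ≤ ENNReal.ofReal K) {q : ℝ} (hq : 1 ≤ q) :
    eLpNorm X (ENNReal.ofReal q) P ≤ ENNReal.ofReal (K * √q) := by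
  have h1 : ENNReal.ofReal (q ^ (-1 / 2 : ℝ)) * eLpNorm X (ENNReal.ofReal q) P
      ≤ ENNReal.ofReal K :=
    (le_iSup (fun p : {p : ℝ // 1 ≤ p} => ENNReal.ofReal ((p : ℝ) ^ (-1 / 2 : ℝ)) *
      eLpNorm X (ENNReal.ofReal (p : ℝ)) P) ⟨q, hq⟩).trans h
  have hq0 : 0 < q := by linarith
  have h2 : q ^ (-1 / 2 : ℝ) = (√q)⁻¹ := by
    rw [Real.sqrt_eq_rpow, ← Real.rpow_neg hq0.le]; norm_num
  rw [h2, ENNReal.ofReal_inv_of_pos (Real.sqrt_pos.2 hq0)] at h1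
  have h3 : ENNReal.ofReal √q ≠ 0 := by simpa using hq0
  rw [ENNReal.ofReal_mul hK, ← ENNReal.div_le_iff h3 ENNReal.ofReal_ne_top, div_eq_mul_inv,
    mul_comm]
  exact h1

lemma lintegral_enorm_pow_le_of_eLpNorm_le {X : Ω → ℝ} {C : ℝ} {q : ℕ} (hq : 1 ≤ q)
    (h1 : eLpNorm X (ENNReal.ofReal q) P ≤ ENNReal.ofReal C) (hC : 0 ≤ C) :
    ∫⁻ ω, ‖X ω‖ₑ ^ q ∂P ≤ ENNReal.ofReal (C ^ q) := by
  have hq0 : q ≠ 0 := by omega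
  rw [ENNReal.ofReal_natCast, eLpNorm_eq_lintegral_rpow_enorm_toReal (by simpa using hq0)
    (by simp)] at h1
  simp only [ENNReal.toReal_natCast, ENNReal.rpow_natCast] at h1
  have h2 := pow_le_pow_left' h1 q
  rw [← ENNReal.rpow_natCast, ← ENNReal.rpow_mul, one_div,
    inv_mul_cancel₀ (by exact_mod_cast hq0), ENNReal.rpow_one] at h2
  rwa [ENNReal.ofReal_pow hC]

lemma lintegral_enorm_pow_le_of_psiNorm_le {X : Ω → ℝ} {K : ℝ} (hK : 0 ≤ K)
    (h : psiNorm 2 X P ≤ ENNReal.ofReal K) {q : ℕ} (hq : 1 ≤ q) :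
    ∫⁻ ω, ‖X ω‖ₑ ^ q ∂P ≤ ENNReal.ofReal ((K * √q) ^ q) :=
  lintegral_enorm_pow_le_of_eLpNorm_le hq
    (eLpNorm_le_of_psiNorm_le hK h (by exact_mod_cast hq)) (by positivity)

/-- The constant `a` for which `E exp (a X²) ≤ 2` whenever `‖X‖_{ψ₂} ≤ K`. -/
noncomputable def expRate (K : ℝ) : ℝ := 1 / (4 * Real.exp 1 * K ^ 2)

lemma expRate_pos {K : ℝ} (hK : 0 < K) : 0 < expRate K := by
  unfold expRate; positivity

/-- Expanding the exponential, the p-th term is at most (p/(2e))^p / p!, and p^p/p! ≤ e^p makes this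
at most 2^{-p}. `expRate` is tuned so that the resulting geometric series sums to 2. -/
lemma lintegral_exp_sq_le_two {X : Ω → ℝ} [IsProbabilityMeasure P] {K : ℝ} (hK : 0 < K)
    (hX : AEMeasurable X P) (h : psiNorm 2 X P ≤ ENNReal.ofReal K) :
    ∫⁻ ω, ENNReal.ofReal (Real.exp (expRate K * X ω ^ 2)) ∂P ≤ 2 := by
  have ha := expRate_pos hK
  have h1 : ∀ ω, ENNReal.ofReal (Real.exp (expRate K * X ω ^ 2)) =
      ∑' p : ℕ, ENNReal.ofReal (expRate K ^ p / p.factorial) * ‖X ω‖ₑ ^ (2 * p) := by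
    intro ω
    rw [Real.exp_eq_exp_ℝ, NormedSpace.exp_eq_tsum_div,
      ENNReal.ofReal_tsum_of_nonneg (fun p => by positivity)
        (NormedSpace.expSeries_div_summable _)]
    refine tsum_congr fun p => ?_
    rw [Real.enorm_eq_ofReal_abs, ← ENNReal.ofReal_pow (abs_nonneg _),
      ← ENNReal.ofReal_mul (by positivity), pow_mul, sq_abs, mul_pow]
    congr 1; ring
  simp_rw [h1]
  rw [lintegral_tsum (fun p => by fun_prop)]
  have h2 : ∀ p : ℕ, ∫⁻ ω, ENNReal.ofReal (expRate K ^ p / p.factorial) * ‖X ω‖ₑ ^ (2 * p) ∂P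
      ≤ ENNReal.ofReal ((1 / 2) ^ p) := by
    intro p
    rw [lintegral_const_mul' _ _ ENNReal.ofReal_ne_top]
    rcases Nat.eq_zero_or_pos p with rfl | hp
    · simp
    refine (mul_le_mul_right (lintegral_enorm_pow_le_of_psiNorm_le hK.le h (q := 2 * p)
      (by omega)) _).trans ?_
    rw [← ENNReal.ofReal_mul (by positivity)]
    refine ENNReal.ofReal_le_ofReal ?_
    have hf := Real.pow_div_factorial_le_exp (x := p) (by positivity) p
    have he : Real.exp p = Real.exp 1 ^ p := by rw [← Real.exp_nat_mul]; simp
    rw [pow_mul, mul_pow, Real.sq_sqrt (by positivity), div_mul_eq_mul_div, ← mul_pow, expRate]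
    have h3 : 1 / (4 * Real.exp 1 * K ^ 2) * (K ^ 2 * ((2 * p : ℕ) : ℝ)) =
        (1 / 2) * (p / Real.exp 1) := by
      push_cast; field_simp; norm_num
    rw [h3, mul_pow, mul_div_assoc]
    refine mul_le_of_le_one_right (by positivity) ?_
    rw [div_pow, div_div, mul_comm, ← div_div, ← he]
    exact (div_le_one (Real.exp_pos _)).2 hf
  refine (ENNReal.tsum_le_tsum h2).trans ?_
  rw [← ENNReal.ofReal_tsum_of_nonneg (fun p => by positivity) summable_geometric_two,
    tsum_geometric_two]
  simp

lemma integrable_of_lintegral_ofReal_le {f : Ω → ℝ} (hf : AEStronglyMeasurable f P)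
    (h0 : ∀ ω, 0 ≤ f ω) {C : ℝ} (hC : 0 ≤ C)
    (h : ∫⁻ ω, ENNReal.ofReal (f ω) ∂P ≤ ENNReal.ofReal C) :
    Integrable f P ∧ ∫ ω, f ω ∂P ≤ C := by
  have hi : Integrable f P :=
    (lintegral_ofReal_ne_top_iff_integrable hf (ae_of_all _ h0)).1
      (h.trans_lt ENNReal.ofReal_lt_top).ne
  refine ⟨hi, ?_⟩
  rw [← ofReal_integral_eq_lintegral_ofReal hi (ae_of_all _ h0)] at h
  exact (ENNReal.ofReal_le_ofReal_iff hC).1 h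

lemma integral_exp_sq_le_two {X : Ω → ℝ} [IsProbabilityMeasure P] {K : ℝ} (hK : 0 < K)
    (hX : AEMeasurable X P) (h : psiNorm 2 X P ≤ ENNReal.ofReal K) :
    Integrable (fun ω => Real.exp (expRate K * X ω ^ 2)) P ∧
      ∫ ω, Real.exp (expRate K * X ω ^ 2) ∂P ≤ 2 := by
  refine integrable_of_lintegral_ofReal_le
    (by fun_prop) (fun ω => (Real.exp_pos _).le) (by norm_num) ?_
  simpa using lintegral_exp_sq_le_two hK hX h

/-- AM-GM twice, first on |XY| and then on the exponentials, so a product of two sub-Gaussian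
variables is sub-exponential with the same rate `a` and the same bound 2. -/
lemma integral_exp_abs_mul_le_two {X Y : Ω → ℝ} {a : ℝ} (ha : 0 ≤ a)
    (hX : AEMeasurable X P) (hY : AEMeasurable Y P)
    (hXi : Integrable (fun ω => Real.exp (a * X ω ^ 2)) P)
    (hYi : Integrable (fun ω => Real.exp (a * Y ω ^ 2)) P)
    (hX2 : ∫ ω, Real.exp (a * X ω ^ 2) ∂P ≤ 2) (hY2 : ∫ ω, Real.exp (a * Y ω ^ 2) ∂P ≤ 2) :
    Integrable (fun ω => Real.exp (a * |X ω * Y ω|)) P ∧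
      ∫ ω, Real.exp (a * |X ω * Y ω|) ∂P ≤ 2 := by
  have hb : ∀ ω, Real.exp (a * |X ω * Y ω|) ≤
      (Real.exp (a * X ω ^ 2) + Real.exp (a * Y ω ^ 2)) / 2 := by
    intro ω
    have h1 : a * |X ω * Y ω| ≤ a * X ω ^ 2 / 2 + a * Y ω ^ 2 / 2 := by
      have h0 : |X ω * Y ω| ≤ X ω ^ 2 / 2 + Y ω ^ 2 / 2 := by
        rw [abs_le]; constructor <;> nlinarith [sq_nonneg (X ω + Y ω), sq_nonneg (X ω - Y ω)]
      nlinarith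
    refine (Real.exp_le_exp.2 h1).trans ?_
    rw [Real.exp_add]
    have e1 : Real.exp (a * X ω ^ 2) = Real.exp (a * X ω ^ 2 / 2) ^ 2 := by
      rw [← Real.exp_nat_mul]; congr 1; push_cast; ring
    have e2 : Real.exp (a * Y ω ^ 2) = Real.exp (a * Y ω ^ 2 / 2) ^ 2 := by
      rw [← Real.exp_nat_mul]; congr 1; push_cast; ring
    rw [e1, e2]
    nlinarith [sq_nonneg (Real.exp (a * X ω ^ 2 / 2) - Real.exp (a * Y ω ^ 2 / 2))]
  have hi2 : Integrable (fun ω => (Real.exp (a * X ω ^ 2) + Real.exp (a * Y ω ^ 2)) / 2) P :=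
    (hXi.add hYi).div_const 2
  have hi : Integrable (fun ω => Real.exp (a * |X ω * Y ω|)) P := by
    refine hi2.mono' (by fun_prop) (ae_of_all _ fun ω => ?_)
    rw [Real.norm_of_nonneg (Real.exp_pos _).le]
    exact hb ω
  refine ⟨hi, (integral_mono hi hi2 hb).trans ?_⟩
  rw [integral_div, integral_add hXi hYi]
  linarith

lemma exp_le_quadratic (x : ℝ) : Real.exp x ≤ 1 + x + x ^ 2 * Real.exp |x| := by
  have h := Complex.norm_exp_sub_sum_le_norm_mul_exp (x : ℂ) 2
  simp only [Finset.sum_range_succ, Finset.sum_range_zero, Nat.factorial, Complex.norm_real,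
    Real.norm_eq_abs, sq_abs] at h
  rw [show Complex.exp x - (0 + (x : ℂ) ^ 0 / ((1 : ℕ) : ℂ) +
    (x : ℂ) ^ 1 / ((Nat.succ 0 * 1 : ℕ) : ℂ)) = ((Real.exp x - (1 + x) : ℝ) : ℂ) by
      push_cast; simp, Complex.norm_real, Real.norm_eq_abs] at h
  linarith [le_abs_self (Real.exp x - (1 + x))]

/-- A random variable with `E exp (a |Z|) ≤ 2` has a sub-exponential moment generating function. -/
lemma integral_exp_mul_sub_le [IsProbabilityMeasure P] {Z : Ω → ℝ} {a t : ℝ} (ha : 0 < a)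
    (hZ : AEMeasurable Z P)
    (hi : Integrable (fun ω => Real.exp (a * |Z ω|)) P)
    (h2 : ∫ ω, Real.exp (a * |Z ω|) ∂P ≤ 2) (ht : |t| ≤ a / 2) :
    Integrable Z P ∧ Integrable (fun ω => Real.exp (t * (Z ω - ∫ ω, Z ω ∂P))) P ∧
      ∫ ω, Real.exp (t * (Z ω - ∫ ω, Z ω ∂P)) ∂P ≤ Real.exp (16 * t ^ 2 / a ^ 2) := by
  have hZi : Integrable Z P := by
    refine (hi.const_mul (1 / a)).mono' hZ.aestronglyMeasurable (ae_of_all _ fun ω => ?_)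
    have := Real.add_one_le_exp (a * |Z ω|)
    rw [Real.norm_eq_abs, one_div, inv_mul_eq_div, le_div_iff₀ ha]
    linarith
  -- Half of the exponential rate absorbs exp |tZ| and the other half absorbs Z²: the inequality
  -- y²/2 ≤ exp y at y = a|Z|/2 gives the constant 8/a². The bound 2 on the expectation then doubles
  -- it to 16/a².
  have hb : ∀ ω, Real.exp (t * Z ω) ≤
      1 + t * Z ω + 8 * t ^ 2 / a ^ 2 * Real.exp (a * |Z ω|) := by
    intro ω
    refine (exp_le_quadratic _).trans ?_
    have h1 : Real.exp |t * Z ω| ≤ Real.exp (a / 2 * |Z ω|) := by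
      rw [abs_mul]
      exact Real.exp_le_exp.2 (mul_le_mul_of_nonneg_right ht (abs_nonneg _))
    have h3 : Z ω ^ 2 ≤ 8 / a ^ 2 * Real.exp (a / 2 * |Z ω|) := by
      have := Real.quadratic_le_exp_of_nonneg (x := a / 2 * |Z ω|) (by positivity)
      have h4 : (a / 2 * |Z ω|) ^ 2 / 2 ≤ Real.exp (a / 2 * |Z ω|) := by
        have : 0 ≤ a / 2 * |Z ω| := by positivity
        linarith
      rw [mul_pow, sq_abs] at h4
      rw [div_mul_eq_mul_div, le_div_iff₀ (by positivity)]
      linarith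
    have h5 : Real.exp (a * |Z ω|) = Real.exp (a / 2 * |Z ω|) * Real.exp (a / 2 * |Z ω|) := by
      rw [← Real.exp_add]; congr 1; ring
    have h6 : (t * Z ω) ^ 2 * Real.exp |t * Z ω| ≤
        t ^ 2 * (8 / a ^ 2 * Real.exp (a / 2 * |Z ω|)) * Real.exp (a / 2 * |Z ω|) := by
      rw [mul_pow]
      gcongr
    rw [h5]
    calc _ ≤ 1 + t * Z ω + t ^ 2 * (8 / a ^ 2 * Real.exp (a / 2 * |Z ω|)) *
          Real.exp (a / 2 * |Z ω|) := by linarith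
      _ = _ := by ring
  have hbi : Integrable (fun ω => 1 + t * Z ω + 8 * t ^ 2 / a ^ 2 * Real.exp (a * |Z ω|)) P :=
    ((integrable_const _).add (hZi.const_mul t)).add (hi.const_mul _)
  have hti : Integrable (fun ω => Real.exp (t * Z ω)) P := by
    refine hbi.mono' (by fun_prop) (ae_of_all _ fun ω => ?_)
    rw [Real.norm_of_nonneg (Real.exp_pos _).le]
    exact hb ω
  set c := ∫ ω, Z ω ∂P
  have he : (fun ω => Real.exp (t * (Z ω - c))) =
      fun ω => Real.exp (-(t * c)) * Real.exp (t * Z ω) := by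
    ext ω; rw [← Real.exp_add]; congr 1; ring
  refine ⟨hZi, he ▸ hti.const_mul _, ?_⟩
  rw [he, integral_const_mul]
  have h7 : ∫ ω, Real.exp (t * Z ω) ∂P ≤ Real.exp (t * c + 16 * t ^ 2 / a ^ 2) := by
    refine (integral_mono hti hbi hb).trans ?_
    rw [integral_add (by exact (integrable_const _).add (hZi.const_mul t)) (hi.const_mul _),
      integral_add (integrable_const _) (hZi.const_mul t), integral_const_mul, integral_const_mul]
    have h8 : 8 * t ^ 2 / a ^ 2 * ∫ ω, Real.exp (a * |Z ω|) ∂P ≤ 8 * t ^ 2 / a ^ 2 * 2 := by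
      gcongr
    have := Real.add_one_le_exp (t * c + 16 * t ^ 2 / a ^ 2)
    simp only [integral_const, probReal_univ, one_smul]
    have h9 : 8 * t ^ 2 / a ^ 2 * 2 = 16 * t ^ 2 / a ^ 2 := by ring
    linarith
  calc _ ≤ Real.exp (-(t * c)) * Real.exp (t * c + 16 * t ^ 2 / a ^ 2) := by gcongr
    _ = _ := by rw [← Real.exp_add]; congr 1; ring

end Moments

/-! ### Chernoff and Bernstein bounds for independent sums. -/

section Concentration

variable {Ω : Type*} [MeasurableSpace Ω] {P : Measure Ω} [IsProbabilityMeasure P]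

lemma measureReal_sum_ge_le {n : ℕ} {Z : Fin n → Ω → ℝ} {t V u : ℝ} (ht : 0 ≤ t)
    (hZ : ∀ i, AEMeasurable (Z i) P) (hind : iIndepFun Z P)
    (hi : ∀ i, Integrable (fun ω => Real.exp (t * Z i ω)) P)
    (hm : ∀ i, ∫ ω, Real.exp (t * Z i ω) ∂P ≤ Real.exp V) :
    P.real {ω | n * u ≤ ∑ i, Z i ω} ≤ Real.exp (n * (V - t * u)) := by
  have hint : Integrable (fun ω => Real.exp (t * (∑ i, Z i) ω)) P := by
    have hae := fun i => (hZ i).ae_eq_mk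
    have h := (hind.congr hae).integrable_exp_mul_sum (s := Finset.univ) (t := t)
      (fun i => (hZ i).measurable_mk) (fun i _ => (hi i).congr (by
        filter_upwards [hae i] with ω hω
        rw [hω]))
    refine h.congr ?_
    filter_upwards [ae_all_iff.2 hae] with ω hω
    simp [Finset.sum_apply, hω]
  have h := measure_ge_le_exp_mul_mgf (μ := P) (X := ∑ i, Z i) (n * u) ht hint
  simp only [Finset.sum_apply] at h
  refine h.trans ?_
  rw [hind.mgf_sum₀ hZ]
  have h1 : ∏ i, mgf (Z i) P t ≤ ∏ _i : Fin n, Real.exp V :=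
    Finset.prod_le_prod (fun i _ => mgf_nonneg) fun i _ => hm i
  rw [Finset.prod_const, Finset.card_univ, Fintype.card_fin, ← Real.exp_nat_mul] at h1
  calc _ ≤ Real.exp (-t * (n * u)) * Real.exp (n * V) := by gcongr
    _ = _ := by rw [← Real.exp_add]; congr 1; ring

/-- Bernstein's inequality for averages of i.i.d. sub-exponential variables. -/
lemma measureReal_abs_mean_sub_ge_le {n : ℕ} (hn : 0 < n) {Z : Fin n → Ω → ℝ} {a c u : ℝ}
    (ha : 0 < a) (hZ : ∀ i, AEMeasurable (Z i) P) (hind : iIndepFun Z P)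
    (hi : ∀ i, Integrable (fun ω => Real.exp (a * |Z i ω|)) P)
    (h2 : ∀ i, ∫ ω, Real.exp (a * |Z i ω|) ∂P ≤ 2)
    (hc : ∀ i, ∫ ω, Z i ω ∂P = c) (hu0 : 0 ≤ u) (hu : u ≤ 16 / a) :
    P.real {ω | u ≤ |(n : ℝ)⁻¹ * ∑ i, Z i ω - c|} ≤
      2 * Real.exp (-(n * (a ^ 2 * u ^ 2 / 64))) := by
  -- The minimizer of 16t²/a² - tu, with minimum -a²u²/64. The condition u ≤ 16/a is exactly t ≤
  -- a/2.
  set t := a ^ 2 * u / 32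
  have ht0 : 0 ≤ t := by positivity
  have ht : |t| ≤ a / 2 := by
    rw [abs_of_nonneg ht0]
    rw [le_div_iff₀ ha] at hu
    simp only [t]; nlinarith
  have key : ∀ σ : ℝ, |σ| = 1 → P.real {ω | n * u ≤ ∑ i, σ * (Z i ω - c)} ≤
      Real.exp (-(n * (a ^ 2 * u ^ 2 / 64))) := by
    intro σ hσ
    have hσ2 : σ ^ 2 = 1 := by rw [← sq_abs, hσ, one_pow]
    have h1 := fun i => integral_exp_mul_sub_le (t := t * σ) ha (hZ i) (hi i) (h2 i)
      (by rw [abs_mul, hσ, mul_one]; exact ht)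
    simp only [hc, mul_assoc t σ] at h1
    have := measureReal_sum_ge_le (P := P) (Z := fun i ω => σ * (Z i ω - c)) (u := u) ht0
      (fun i => by have := hZ i; fun_prop)
      (hind.comp (fun _ x => σ * (x - c)) (fun _ => by fun_prop)) (fun i => (h1 i).2.1)
      (fun i => (h1 i).2.2)
    refine this.trans (le_of_eq ?_)
    congr 1
    rw [mul_pow, hσ2]
    simp only [t]; field_simp; ring
  have hsub : {ω | u ≤ |(n : ℝ)⁻¹ * ∑ i, Z i ω - c|} ⊆
      {ω | n * u ≤ ∑ i, 1 * (Z i ω - c)} ∪ {ω | n * u ≤ ∑ i, (-1) * (Z i ω - c)} := by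
    intro ω hω
    have hn' : (0 : ℝ) < n := by exact_mod_cast hn
    simp only [Set.mem_ofPred_eq, Set.mem_union, ← Finset.mul_sum, Finset.sum_sub_distrib,
      Finset.sum_const, Finset.card_univ, Fintype.card_fin, nsmul_eq_mul] at hω ⊢
    have h3 : (n : ℝ)⁻¹ * ∑ i, Z i ω - c = (∑ i, Z i ω - n * c) / n := by field_simp
    rw [h3, abs_div, abs_of_pos hn', le_div_iff₀ hn', le_abs] at hω
    rcases hω with h | h
    · left; linarith
    · right; linarith
  calc _ ≤ _ := measureReal_mono hsub
    _ ≤ _ := measureReal_union_le _ _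
    _ ≤ _ := by linarith [key 1 (by simp), key (-1) (by simp)]

end Concentration

/-! ### Moments of linear and bilinear forms under the population law. -/

section PopulationMoments

variable {d : ℕ} {μ : Measure (Fin d → ℝ)} {K : ℝ}

lemma memLp_coord (hK : 0 ≤ K) {j : Fin d}
    (h : psiNorm 2 (fun x : Fin d → ℝ => x j) μ ≤ ENNReal.ofReal K) {q : ℝ} (hq : 1 ≤ q) :
    MemLp (fun x : Fin d → ℝ => x j) (ENNReal.ofReal q) μ :=
  ⟨(measurable_pi_apply j).aestronglyMeasurable,
    (eLpNorm_le_of_psiNorm_le hK h hq).trans_lt ENNReal.ofReal_lt_top⟩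

lemma memLp_two_coord (hK : 0 ≤ K) {j : Fin d}
    (h : psiNorm 2 (fun x : Fin d → ℝ => x j) μ ≤ ENNReal.ofReal K) :
    MemLp (fun x : Fin d → ℝ => x j) 2 μ := by
  simpa using memLp_coord hK h (q := 2) (by norm_num)

lemma popCov_apply [IsProbabilityMeasure μ] (hK : 0 ≤ K)
    (h0 : ∀ j, ∫ x, x j ∂μ = 0)
    (h : ∀ j, psiNorm 2 (fun x : Fin d → ℝ => x j) μ ≤ ENNReal.ofReal K) (j k : Fin d) :
    popCov μ j k = ∫ x, x j * x k ∂μ := by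
  rw [popCov, Matrix.of_apply, covariance_eq_sub (memLp_two_coord hK (h j))
    (memLp_two_coord hK (h k)), h0, zero_mul, sub_zero]
  rfl

/-- Minkowski's inequality: an ℓ₁ bound on the coefficients keeps linear forms sub-Gaussian with a
constant independent of the dimension. -/
lemma eLpNorm_dotProduct_le (hK : 0 ≤ K)
    (h : ∀ j, psiNorm 2 (fun x : Fin d → ℝ => x j) μ ≤ ENNReal.ofReal K) {v : Fin d → ℝ} {L : ℝ}
    (hv : l1 v ≤ L) {q : ℝ} (hq : 1 ≤ q) :
    eLpNorm (fun x : Fin d → ℝ => v ⬝ᵥ x) (ENNReal.ofReal q) μ ≤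
      ENNReal.ofReal (L * (K * √q)) := by
  have h1 : (fun x : Fin d → ℝ => v ⬝ᵥ x) = ∑ j, fun x : Fin d → ℝ => v j * x j := by
    ext x; simp [dotProduct]
  rw [h1]
  refine (eLpNorm_sum_le (fun j _ => ((measurable_pi_apply j).const_mul _).aestronglyMeasurable)
    (by simpa using hq)).trans ?_
  have h2 : ∀ j, eLpNorm (fun x : Fin d → ℝ => v j * x j) (ENNReal.ofReal q) μ ≤
      ENNReal.ofReal (|v j| * (K * √q)) := by
    intro j
    have : (fun x : Fin d → ℝ => v j * x j) = v j • fun x : Fin d → ℝ => x j := by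
      ext x; simp
    rw [this, eLpNorm_const_smul, ENNReal.ofReal_mul (abs_nonneg _), Real.enorm_eq_ofReal_abs]
    exact mul_le_mul_right (eLpNorm_le_of_psiNorm_le hK (h j) hq) _
  refine (Finset.sum_le_sum fun j _ => h2 j).trans ?_
  rw [← ENNReal.ofReal_sum_of_nonneg (fun j _ => by positivity), ← Finset.sum_mul]
  exact ENNReal.ofReal_le_ofReal (mul_le_mul_of_nonneg_right hv (by positivity))

lemma integral_dotProduct_pow_eight_le (hK : 0 ≤ K)
    (h : ∀ j, psiNorm 2 (fun x : Fin d → ℝ => x j) μ ≤ ENNReal.ofReal K) {v : Fin d → ℝ} {L : ℝ}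
    (hL : 0 ≤ L) (hv : l1 v ≤ L) :
    Integrable (fun x : Fin d → ℝ => (v ⬝ᵥ x) ^ 8) μ ∧
      ∫ x, (v ⬝ᵥ x) ^ 8 ∂μ ≤ (L * (K * √8)) ^ 8 := by
  refine integrable_of_lintegral_ofReal_le (Measurable.aestronglyMeasurable
    (by unfold dotProduct; fun_prop))
    (fun x => by positivity) (by positivity) ?_
  have h1 := lintegral_enorm_pow_le_of_eLpNorm_le (q := 8) (by norm_num)
    (eLpNorm_dotProduct_le hK h hv (q := (8 : ℕ)) (by norm_num)) (by positivity)
  push_cast at h1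
  refine le_trans (le_of_eq ?_) h1
  refine lintegral_congr fun x => ?_
  rw [Real.enorm_eq_ofReal_abs, ← ENNReal.ofReal_pow (abs_nonneg _), Even.pow_abs (by decide)]

lemma bilin_outer (v b x : Fin d → ℝ) : bilin v (outer x) b = (v ⬝ᵥ x) * (b ⬝ᵥ x) := by
  rw [bilin, outer, vecMulVec_mulVec, dotProduct_comm b x]
  simp [dotProduct, Finset.sum_mul, mul_assoc]

lemma measurable_bilin_outer (v b : Fin d → ℝ) :
    Measurable fun x : Fin d → ℝ => bilin v (outer x) b := by
  simp_rw [bilin_outer, dotProduct]; fun_prop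

/-- The form is a product of two linear forms, so AM-GM reduces its fourth moment to eighth moments.
This bound, uniform in the dimension, feeds both the CLT and the consistency of Δ̂. -/
lemma integral_bilin_pow_four_le (hK : 0 ≤ K)
    (h : ∀ j, psiNorm 2 (fun x : Fin d → ℝ => x j) μ ≤ ENNReal.ofReal K) {v b : Fin d → ℝ} {L : ℝ}
    (hL : 0 ≤ L) (hv : l1 v ≤ L) (hb : l1 b ≤ L) :
    Integrable (fun x : Fin d → ℝ => bilin v (outer x) b ^ 4) μ ∧
      ∫ x, bilin v (outer x) b ^ 4 ∂μ ≤ (L * (K * √8)) ^ 8 := by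
  obtain ⟨hvi, hv8⟩ := integral_dotProduct_pow_eight_le hK h hL hv
  obtain ⟨hbi, hb8⟩ := integral_dotProduct_pow_eight_le hK h hL hb
  have hle : ∀ x : Fin d → ℝ, bilin v (outer x) b ^ 4 ≤ ((v ⬝ᵥ x) ^ 8 + (b ⬝ᵥ x) ^ 8) / 2 := by
    intro x
    rw [bilin_outer]
    nlinarith [sq_nonneg ((v ⬝ᵥ x) ^ 4 - (b ⬝ᵥ x) ^ 4)]
  have hi2 : Integrable (fun x : Fin d → ℝ => ((v ⬝ᵥ x) ^ 8 + (b ⬝ᵥ x) ^ 8) / 2) μ :=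
    (hvi.add hbi).div_const 2
  have hi : Integrable (fun x : Fin d → ℝ => bilin v (outer x) b ^ 4) μ := by
    refine hi2.mono' ((measurable_bilin_outer v b).pow_const 4).aestronglyMeasurable
      (ae_of_all _ fun x => ?_)
    rw [Real.norm_of_nonneg (by positivity)]
    exact hle x
  refine ⟨hi, (integral_mono hi hi2 hle).trans ?_⟩
  rw [integral_div, integral_add hvi hbi]
  linarith

lemma memLp_four_of_integrable_pow {Ω : Type*} [MeasurableSpace Ω] {P : Measure Ω} {f : Ω → ℝ}
    (hf : AEStronglyMeasurable f P) (hi : Integrable (fun ω => f ω ^ 4) P) : MemLp f 4 P := by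
  rw [← integrable_norm_rpow_iff hf (by norm_num) (by norm_num)]
  refine hi.congr (ae_of_all _ fun ω => ?_)
  simp only [ENNReal.toReal_ofNat]
  rw [show (4 : ℝ) = ((4 : ℕ) : ℝ) by norm_num, Real.rpow_natCast, Real.norm_eq_abs,
    Even.pow_abs (by decide)]

lemma integral_bilin_outer [IsProbabilityMeasure μ] (hK : 0 ≤ K)
    (h0 : ∀ j, ∫ x, x j ∂μ = 0)
    (h : ∀ j, psiNorm 2 (fun x : Fin d → ℝ => x j) μ ≤ ENNReal.ofReal K) (v b : Fin d → ℝ) :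
    ∫ x, bilin v (outer x) b ∂μ = v ⬝ᵥ (popCov μ *ᵥ b) := by
  have h1 : ∀ x : Fin d → ℝ, bilin v (outer x) b = ∑ j, ∑ k, v j * b k * (x j * x k) := by
    intro x
    rw [bilin_outer, dotProduct, dotProduct, Finset.sum_mul_sum]
    exact Finset.sum_congr rfl fun j _ => Finset.sum_congr rfl fun k _ => by ring
  have hi : ∀ j k, Integrable (fun x : Fin d → ℝ => x j * x k) μ := fun j k =>
    (memLp_two_coord hK (h j)).integrable_mul (memLp_two_coord hK (h k))
  simp_rw [h1]
  rw [integral_finsetSum _ fun j _ => integrable_finsetSum _ fun k _ => (hi j k).const_mul _]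
  rw [dotProduct]
  refine Finset.sum_congr rfl fun j _ => ?_
  rw [integral_finsetSum _ fun k _ => (hi j k).const_mul _, mulVec, dotProduct, Finset.mul_sum]
  refine Finset.sum_congr rfl fun k _ => ?_
  rw [integral_const_mul, popCov_apply hK h0 h]
  ring

lemma popCov_diag_le [IsProbabilityMeasure μ] (hK : 0 ≤ K)
    (h0 : ∀ j, ∫ x, x j ∂μ = 0)
    (h : ∀ j, psiNorm 2 (fun x : Fin d → ℝ => x j) μ ≤ ENNReal.ofReal K) (j : Fin d) :
    popCov μ j j ≤ 2 * K ^ 2 := by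
  rw [popCov_apply hK h0 h]
  have h1 := lintegral_enorm_pow_le_of_psiNorm_le hK (h j) (q := 2) (by norm_num)
  refine (integrable_of_lintegral_ofReal_le (C := 2 * K ^ 2) (by fun_prop)
    (fun x => mul_self_nonneg _) (by positivity) ?_).2
  refine (le_of_eq (lintegral_congr fun x => ?_)).trans (h1.trans (le_of_eq ?_))
  · rw [Real.enorm_eq_ofReal_abs, ← ENNReal.ofReal_pow (abs_nonneg _), sq_abs, sq]
  · rw [mul_pow, Real.sq_sqrt (by positivity)]; push_cast; rw [mul_comm]

end PopulationMoments

/-! ### Deviations of the sample covariance, of the coordinates and of averages. -/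

section SampleConcentration

variable {Ω : Type*} [MeasurableSpace Ω] {P : Measure Ω}
  {n d : ℕ} {μ : Measure (Fin d → ℝ)} [IsProbabilityMeasure μ] {K : ℝ}
  {X : Fin n → Ω → (Fin d → ℝ)}

lemma sampleCov_apply (x : Fin n → Fin d → ℝ) (j k : Fin d) :
    sampleCov x j k = (n : ℝ)⁻¹ * ∑ i, x i j * x i k := by
  simp [sampleCov, outer, Matrix.sum_apply, vecMulVec_apply]

/-- Bernstein's inequality for each product of coordinates and a union bound over the d² entries.
The level `u` is left free, since it is used at two different rates. -/
lemma measureReal_sampleCov_sub_ge_le [IsProbabilityMeasure P] (hn : 0 < n) (hK : 0 < K)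
    (h0 : ∀ j, ∫ x, x j ∂μ = 0)
    (h : ∀ j, psiNorm 2 (fun x : Fin d → ℝ => x j) μ ≤ ENNReal.ofReal K)
    (hX : ∀ i, HasLaw (X i) μ P) (hind : iIndepFun X P) {u : ℝ} (hu0 : 0 ≤ u)
    (hu : u ≤ 16 / expRate K) :
    P.real {ω | ∃ j k, u ≤ |sampleCov (fun i => X i ω) j k - popCov μ j k|} ≤
      2 * d ^ 2 * Real.exp (-(n * (expRate K ^ 2 * u ^ 2 / 64))) := by
  have ha := expRate_pos hK
  have hexp := fun j => integral_exp_sq_le_two hK (P := μ) (X := fun x : Fin d → ℝ => x j)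
    (measurable_pi_apply j).aemeasurable (h j)
  have hjk : ∀ j k, P.real {ω | u ≤ |sampleCov (fun i => X i ω) j k - popCov μ j k|} ≤
      2 * Real.exp (-(n * (expRate K ^ 2 * u ^ 2 / 64))) := by
    intro j k
    have h1 := integral_exp_abs_mul_le_two (P := μ) ha.le (X := fun x : Fin d → ℝ => x j)
      (Y := fun x : Fin d → ℝ => x k) (measurable_pi_apply j).aemeasurable
      (measurable_pi_apply k).aemeasurable
      (hexp j).1 (hexp k).1 (hexp j).2 (hexp k).2
    have hm : AEStronglyMeasurable (fun x : Fin d → ℝ => Real.exp (expRate K * |x j * x k|)) μ :=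
      by fun_prop
    simp_rw [sampleCov_apply]
    refine measureReal_abs_mean_sub_ge_le (Z := fun i ω => X i ω j * X i ω k) hn ha ?_ ?_ ?_ ?_ ?_
      hu0 hu
    · intro i
      have := (hX i).aemeasurable
      fun_prop
    · exact hind.comp (fun _ x => x j * x k) fun _ => by fun_prop
    · intro i
      have := h1.1
      rw [← (hX i).map_eq] at this
      exact this.comp_aemeasurable (hX i).aemeasurable
    · intro i
      have := (hX i).integral_comp hm
      rw [Function.comp_def] at this
      rw [this]
      exact h1.2
    · intro i
      have := (hX i).integral_comp (f := fun x : Fin d → ℝ => x j * x k) (by fun_prop)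
      rw [Function.comp_def] at this
      rw [this, popCov_apply hK.le h0 h]
  have hset : {ω | ∃ j k, u ≤ |sampleCov (fun i => X i ω) j k - popCov μ j k|} =
      ⋃ p : Fin d × Fin d, {ω | u ≤ |sampleCov (fun i => X i ω) p.1 p.2 - popCov μ p.1 p.2|} := by
    ext ω; simp
  rw [hset]
  refine (measureReal_iUnion_fintype_le _).trans ?_
  refine (Finset.sum_le_sum fun p _ => hjk p.1 p.2).trans (le_of_eq ?_)
  simp only [Finset.sum_const, Finset.card_univ, Fintype.card_prod, Fintype.card_fin, nsmul_eq_mul]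
  push_cast; ring

lemma measureReal_exists_sq_ge_le (hK : 0 < K)
    (h : ∀ j, psiNorm 2 (fun x : Fin d → ℝ => x j) μ ≤ ENNReal.ofReal K)
    (hX : ∀ i, HasLaw (X i) μ P) (u : ℝ) :
    P.real {ω | ∃ i j, u ≤ X i ω j ^ 2} ≤ 2 * (n * d) * Real.exp (-(expRate K * u)) := by
  have ha := expRate_pos hK
  have hij : ∀ i j, P.real {ω | u ≤ X i ω j ^ 2} ≤ 2 * Real.exp (-(expRate K * u)) := by
    intro i j
    obtain ⟨h1, h2⟩ := integral_exp_sq_le_two hK (P := μ) (X := fun x : Fin d → ℝ => x j)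
      (measurable_pi_apply j).aemeasurable (h j)
    have h3 := mul_meas_ge_le_integral_of_nonneg
      (ae_of_all μ fun x => (Real.exp_pos (expRate K * x j ^ 2)).le) h1
      (Real.exp (expRate K * u))
    have h4 : {x : Fin d → ℝ | Real.exp (expRate K * u) ≤ Real.exp (expRate K * x j ^ 2)} =
        {x | u ≤ x j ^ 2} := by
      ext x; simp [ha]
    have h5 := (hX i).measureReal_eq (p := fun x => u ≤ x j ^ 2)
      (measurableSet_le (by fun_prop) (by fun_prop))
    rw [h4] at h3
    rw [h5, Real.exp_neg, ← div_eq_mul_inv, le_div_iff₀ (Real.exp_pos _), mul_comm]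
    exact h3.trans h2
  have hset : {ω | ∃ i j, u ≤ X i ω j ^ 2} =
      ⋃ p : Fin n × Fin d, {ω | u ≤ X p.1 ω p.2 ^ 2} := by
    ext ω; simp
  rw [hset]
  refine (measureReal_iUnion_fintype_le _).trans ?_
  refine (Finset.sum_le_sum fun p _ => hij p.1 p.2).trans (le_of_eq ?_)
  simp only [Finset.sum_const, Finset.card_univ, Fintype.card_prod, Fintype.card_fin, nsmul_eq_mul]
  push_cast; ring

lemma measureReal_abs_mean_sub_ge_le_of_variance [IsProbabilityMeasure P] (hn : 0 < n)
    {Z : Fin n → Ω → ℝ} {c V ε : ℝ}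
    (hZ : ∀ i, MemLp (Z i) 2 P) (hind : iIndepFun Z P) (hc : ∀ i, ∫ ω, Z i ω ∂P = c)
    (hV : ∀ i, variance (Z i) P ≤ V) (hε : 0 < ε) :
    P.real {ω | ε ≤ |(n : ℝ)⁻¹ * ∑ i, Z i ω - c|} ≤ V / (n * ε ^ 2) := by
  have hn' : (0 : ℝ) < n := by exact_mod_cast hn
  have hsum : MemLp (∑ i, Z i) 2 P := memLp_finsetSum' _ fun i _ => hZ i
  have h1 := meas_ge_le_variance_div_sq hsum (c := n * ε) (by positivity)
  have hE : ∫ ω, (∑ i, Z i) ω ∂P = n * c := by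
    simp only [Finset.sum_apply]
    rw [integral_finsetSum _ fun i _ => (hZ i).integrable (by norm_num)]
    simp [hc]
  have hvar : variance (∑ i, Z i) P ≤ n * V := by
    rw [IndepFun.variance_sum (fun i _ => hZ i) fun i _ j _ hij => hind.indepFun hij]
    refine (Finset.sum_le_sum fun i _ => hV i).trans (le_of_eq ?_)
    simp
  have hset : {ω | ε ≤ |(n : ℝ)⁻¹ * ∑ i, Z i ω - c|} =
      {ω | n * ε ≤ |(∑ i, Z i) ω - ∫ ω, (∑ i, Z i) ω ∂P|} := by
    ext ω
    rw [hE]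
    simp only [Set.mem_ofPred_eq, Finset.sum_apply]
    rw [show (n : ℝ)⁻¹ * ∑ i, Z i ω - c = (∑ i, Z i ω - n * c) / n by field_simp, abs_div,
      abs_of_pos hn', le_div_iff₀ hn', mul_comm]
  rw [hset]
  have h2 := ENNReal.toReal_mono ENNReal.ofReal_ne_top h1
  rw [ENNReal.toReal_ofReal (div_nonneg (variance_nonneg _ _) (by positivity))] at h2
  refine h2.trans ?_
  calc _ ≤ n * V / (n * ε) ^ 2 := by gcongr
    _ = _ := by field_simp

end SampleConcentration

/-! ### Central limit theorem for triangular arrays, and Slutsky's theorem. -/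

section CentralLimit

/-- Taylor's formula for |x| ≤ 1 and the triangle inequality beyond. Having one cubic bound for all
x makes truncation unnecessary in the CLT. -/
lemma norm_cexp_mul_I_sub_le (x : ℝ) :
    ‖Complex.exp (x * Complex.I) - (1 + x * Complex.I - x ^ 2 / 2)‖ ≤ 5 * |x| ^ 3 := by
  rcases le_total |x| 1 with hx | hx
  · have h := Complex.exp_bound (x := x * Complex.I) (by simpa using hx) (n := 3) (by norm_num)
    have h2 : ∑ m ∈ Finset.range 3, ((x : ℂ) * Complex.I) ^ m / m.factorial =
        1 + x * Complex.I - x ^ 2 / 2 := by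
      simp [Finset.sum_range_succ, Nat.factorial, mul_pow]; ring
    rw [h2] at h
    refine h.trans ?_
    simp only [norm_mul, Complex.norm_real, Complex.norm_I, mul_one, Real.norm_eq_abs]
    have : (0 : ℝ) ≤ |x| ^ 3 := by positivity
    norm_num [Nat.factorial]
    linarith
  · have h1 : ‖Complex.exp (x * Complex.I)‖ = 1 := Complex.norm_exp_ofReal_mul_I x
    have h2 : ‖(1 : ℂ) + x * Complex.I - x ^ 2 / 2‖ ≤ 1 + |x| + |x| ^ 2 / 2 := by
      refine (norm_sub_le _ _).trans ?_
      refine add_le_add ((norm_add_le _ _).trans ?_) ?_ <;> simp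
    refine (norm_sub_le _ _).trans ?_
    rw [h1]
    nlinarith [mul_nonneg (sub_nonneg.2 hx) (sub_nonneg.2 hx), sq_nonneg |x|,
      mul_nonneg (sq_nonneg |x|) (sub_nonneg.2 hx)]

lemma norm_charFun_sub_le {ν : Measure ℝ} [IsProbabilityMeasure ν] {C : ℝ}
    (h4 : Integrable (fun x => x ^ 4) ν) (h0 : ∫ x, x ∂ν = 0) (h1 : ∫ x, x ^ 2 ∂ν = 1)
    (hC : ∫ x, x ^ 4 ∂ν ≤ C) (s : ℝ) :
    ‖charFun ν s - (1 - s ^ 2 / 2)‖ ≤ 5 * |s| ^ 3 * (1 + C) := by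
  have hm4 : MemLp (fun x : ℝ => x) 4 ν := memLp_four_of_integrable_pow (by fun_prop) h4
  have hi1 : Integrable (fun x : ℝ => x) ν := hm4.integrable (by norm_num)
  have hi2 : Integrable (fun x : ℝ => x ^ 2) ν :=
    (hm4.mono_exponent (by norm_num : (2 : ℝ≥0∞) ≤ 4)).integrable_sq
  have hb : ∀ x : ℝ, ‖Complex.exp (s * x * Complex.I) -
      (1 + (s * x : ℝ) * Complex.I - (s ^ 2 * x ^ 2 / 2 : ℝ))‖ ≤
      5 * |s| ^ 3 * (x ^ 2 + x ^ 4) := by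
    intro x
    have h := norm_cexp_mul_I_sub_le (s * x)
    -- Avoids a separate third moment: the second moment is 1 and the fourth is at most C.
    have h3 : |x| ^ 3 ≤ x ^ 2 + x ^ 4 := by
      rw [← sq_abs x, ← Even.pow_abs (by decide : Even 4) x]
      nlinarith [sq_nonneg (|x| * (|x| - 1)), sq_nonneg |x|, pow_nonneg (abs_nonneg x) 4]
    rw [abs_mul, mul_pow] at h
    calc _ = ‖Complex.exp ((s * x : ℝ) * Complex.I) -
          (1 + (s * x : ℝ) * Complex.I - ((s * x : ℝ) : ℂ) ^ 2 / 2)‖ := by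
          congr 1; push_cast; ring
      _ ≤ 5 * (|s| ^ 3 * |x| ^ 3) := h
      _ ≤ 5 * |s| ^ 3 * (x ^ 2 + x ^ 4) := by
          rw [← mul_assoc]; gcongr
  have hI1 : Integrable (fun x : ℝ => Complex.exp (s * x * Complex.I)) ν := by
    refine (integrable_const (1 : ℝ)).mono' (by fun_prop) (ae_of_all _ fun x => ?_)
    rw [← Complex.ofReal_mul, Complex.norm_exp_ofReal_mul_I]
  have hIa : Integrable (fun x : ℝ => ((s * x : ℝ) : ℂ) * Complex.I) ν :=
    ((hi1.const_mul s).ofReal).mul_const _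
  have hIb : Integrable (fun x : ℝ => ((s ^ 2 * x ^ 2 / 2 : ℝ) : ℂ)) ν :=
    ((hi2.const_mul (s ^ 2)).div_const 2).ofReal
  have hI2 : Integrable (fun x : ℝ => (1 : ℂ) + (s * x : ℝ) * Complex.I) ν :=
    (integrable_const (1 : ℂ)).add hIa
  have heq : charFun ν s - (1 - s ^ 2 / 2) = ∫ x : ℝ, (Complex.exp (s * x * Complex.I) -
      (1 + (s * x : ℝ) * Complex.I - (s ^ 2 * x ^ 2 / 2 : ℝ))) ∂ν := by
    have e1 : ∫ x : ℝ, ((s * x : ℝ) : ℂ) ∂ν = 0 := by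
      rw [integral_complex_ofReal, integral_const_mul, h0]; simp
    have e2 : ∫ x : ℝ, ((s ^ 2 * x ^ 2 / 2 : ℝ) : ℂ) ∂ν = s ^ 2 / 2 := by
      rw [integral_complex_ofReal, integral_div, integral_const_mul, h1]; simp
    rw [integral_sub hI1 (by exact hI2.sub hIb), ← charFun_apply_real,
      integral_sub hI2 hIb, integral_add (integrable_const _) hIa, integral_mul_const, e1, e2]
    simp
  rw [heq]
  refine (norm_integral_le_integral_norm _).trans ?_
  refine (integral_mono_of_nonneg (ae_of_all _ fun x => norm_nonneg _)
    ((hi2.add h4).const_mul _) (ae_of_all _ hb)).trans ?_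
  simp only [Pi.add_apply]
  rw [integral_const_mul, integral_add hi2 h4, h1]
  gcongr

/-- A central limit theorem for triangular arrays with i.i.d. rows and bounded fourth moments. -/
theorem tendsto_measureReal_sum_le {Ω : ℕ → Type*} [∀ n, MeasurableSpace (Ω n)]
    {P : ∀ n, Measure (Ω n)} [∀ n, IsProbabilityMeasure (P n)]
    {ν : ℕ → Measure ℝ} [∀ n, IsProbabilityMeasure (ν n)] {Z : ∀ n, Fin n → Ω n → ℝ} {C : ℝ}
    (hZ : ∀ n i, HasLaw (Z n i) (ν n) (P n)) (hind : ∀ n, iIndepFun (Z n) (P n))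
    (h4 : ∀ n, Integrable (fun x => x ^ 4) (ν n)) (h0 : ∀ n, ∫ x, x ∂(ν n) = 0)
    (h1 : ∀ n, ∫ x, x ^ 2 ∂(ν n) = 1) (hC : ∀ n, ∫ x, x ^ 4 ∂(ν n) ≤ C) (t : ℝ) :
    Tendsto (fun n => (P n).real {ω | (√(n : ℝ))⁻¹ * ∑ i, Z n i ω ≤ t}) atTop
      (𝓝 (cdf (gaussianReal 0 1) t)) := by
  have hmeas : ∀ n : ℕ, AEMeasurable (fun ω => (√(n : ℝ))⁻¹ * ∑ i, Z n i ω) (P n) := fun n =>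
    (Finset.aemeasurable_fun_sum _ fun i _ => (hZ n i).aemeasurable).const_mul _
  let ρ : ℕ → ProbabilityMeasure ℝ := fun n =>
    ⟨(P n).map fun ω => (√(n : ℝ))⁻¹ * ∑ i, Z n i ω,
      Measure.isProbabilityMeasure_map (hmeas n)⟩
  have hchar : ∀ n s, charFun (ρ n : Measure ℝ) s = charFun (ν n) ((√(n : ℝ))⁻¹ * s) ^ n := by
    intro n s
    simp only [ρ, ProbabilityMeasure.coe_mk]
    rw [charFun_map_mul_comp (Finset.aemeasurable_fun_sum _ fun i _ => (hZ n i).aemeasurable),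
      (hind n).charFun_map_fun_sum_eq_prod fun i => (hZ n i).aemeasurable]
    simp [(hZ n _).map_eq]
  have hC0 : 0 ≤ C := (integral_nonneg fun x => by positivity).trans (hC 0)
  have hlim : Tendsto ρ atTop (𝓝 ⟨gaussianReal 0 1, inferInstance⟩) := by
    refine ProbabilityMeasure.tendsto_iff_tendsto_charFun.2 fun s => ?_
    simp only [hchar, ProbabilityMeasure.coe_mk, charFun_gaussianReal]
    have he : Complex.exp (s * (0 : ℝ) * Complex.I - (1 : NNReal) * s ^ 2 / 2) =
        Complex.exp (-s ^ 2 / 2) := by congr 1; simp; ring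
    rw [he]
    refine Complex.tendsto_pow_exp_of_isLittleO_sub_add_div _ ?_
    -- The characteristic function at s/√n is 1 - s²/(2n) + O(n^{-3/2}), uniformly over the laws `ν
    -- n`. An o(1/n) error is enough for the n-th power to converge to exp(-s²/2).
    have hO : (fun n : ℕ => charFun (ν n) ((√(n : ℝ))⁻¹ * s) - (1 + -s ^ 2 / 2 / n)) =O[atTop]
        fun n : ℕ => (√(n : ℝ))⁻¹ * (1 / n : ℝ) := by
      refine IsBigO.of_bound (5 * |s| ^ 3 * (1 + C)) ?_
      filter_upwards [eventually_gt_atTop 0] with n hn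
      have hn' : (0 : ℝ) < n := by exact_mod_cast hn
      have h := norm_charFun_sub_le (h4 n) (h0 n) (h1 n) (hC n) ((√(n : ℝ))⁻¹ * s)
      have hsq : ((√(n : ℝ))⁻¹) ^ 2 = 1 / (n : ℝ) := by
        rw [inv_pow, Real.sq_sqrt hn'.le, one_div]
      have e1 : (1 : ℂ) - (((√(n : ℝ))⁻¹ * s : ℝ) : ℂ) ^ 2 / 2 = 1 + -s ^ 2 / 2 / n := by
        rw [← Complex.ofReal_pow, mul_pow, hsq]; push_cast; ring
      rw [e1] at h
      refine h.trans (le_of_eq ?_)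
      rw [abs_mul, mul_pow, abs_of_nonneg (by positivity : 0 ≤ (√(n : ℝ))⁻¹), pow_succ _ 2, hsq,
        Real.norm_of_nonneg (by positivity)]
      ring
    have ho : (fun n : ℕ => (√(n : ℝ))⁻¹ * (1 / n : ℝ)) =o[atTop] fun n : ℕ => (1 / n : ℝ) := by
      have : Tendsto (fun n : ℕ => (√(n : ℝ))⁻¹) atTop (𝓝 0) :=
        tendsto_inv_atTop_zero.comp (Real.tendsto_sqrt_atTop.comp tendsto_natCast_atTop_atTop)
      simpa using ((isLittleO_one_iff ℝ).2 this).mul_isBigO (isBigO_refl (fun n : ℕ => (1 / n : ℝ)) _)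
    refine (hO.trans_isLittleO ho).trans_isBigO (IsBigO.of_bound 1 (Eventually.of_forall fun n => ?_))
    simp
  have : NullSingletonClass (gaussianReal 0 1) := nullSingletonClass_gaussianReal one_ne_zero
  have hport := ProbabilityMeasure.tendsto_measure_of_null_frontier_of_tendsto' hlim
    (E := Set.Iic t) (by simp)
  rw [ProbabilityMeasure.coe_mk] at hport
  have h5 := (ENNReal.tendsto_toReal (measure_ne_top (gaussianReal 0 1) _)).comp hport
  rw [cdf_eq_real]
  refine h5.congr fun n => ?_
  simp only [Function.comp, ρ, ProbabilityMeasure.coe_mk]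
  rw [Measure.map_apply_of_aemeasurable (hmeas n) measurableSet_Iic]
  rfl

lemma continuous_cdf_gaussianReal : Continuous (cdf (gaussianReal 0 1)) := by
  have : NullSingletonClass (gaussianReal 0 1) := nullSingletonClass_gaussianReal one_ne_zero
  refine continuous_iff_continuousAt.2 fun t => ?_
  have h := (cdf (gaussianReal 0 1)).measure_singleton t
  rw [measure_cdf, measure_singleton] at h
  have h1 := (monotone_cdf (gaussianReal 0 1)).leftLim_le (le_refl t)
  have h2 : Function.leftLim (cdf (gaussianReal 0 1)) t = cdf (gaussianReal 0 1) t := by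
    have := ENNReal.ofReal_eq_zero.1 h.symm
    linarith
  rw [(monotone_cdf _).continuousAt_iff_leftLim_eq_rightLim, h2, StieltjesFunction.rightLim_eq]

/-- A form of Slutsky's theorem along varying probability spaces. -/
theorem tendsto_measureReal_le_of_slutsky {Ω : ℕ → Type*} [∀ n, MeasurableSpace (Ω n)]
    {P : ∀ n, Measure (Ω n)} [∀ n, IsProbabilityMeasure (P n)] {W U : ∀ n, Ω n → ℝ} {F : ℝ → ℝ}
    (hF : Continuous F) (hW : ∀ t, Tendsto (fun n => (P n).real {ω | W n ω ≤ t}) atTop (𝓝 (F t)))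
    (hU : ∀ η : ℝ, 0 < η → ∀ ε : ℝ, 0 < ε → ∀ᶠ n in atTop, (P n).real
      {ω | ¬ ∃ q r : ℝ, |q - 1| ≤ η ∧ |r| ≤ η ∧ W n ω + r = q * U n ω} ≤ ε) (t : ℝ) :
    Tendsto (fun n => (P n).real {ω | U n ω ≤ t}) atTop (𝓝 (F t)) := by
  rw [Metric.tendsto_nhds]
  intro ε hε
  obtain ⟨η₀, hη₀, hη⟩ := Metric.continuousAt_iff.1 hF.continuousAt (ε / 4) (by linarith)
  set κ := η₀ / 2
  have hκ : 0 < κ := by positivity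
  -- The bound 1/2 keeps q positive. The other bound makes qt - r lie within κ of t, so off the bad
  -- event U ≤ t is implied by W ≤ t - κ and implies W ≤ t + κ.
  set η := min (1 / 2) (κ / (|t| + 1))
  have ht : 0 < |t| + 1 := by positivity
  have hη1 : 0 < η := lt_min (by norm_num) (by positivity)
  have hη2 : η ≤ 1 / 2 := min_le_left _ _
  have hη3 : η * (|t| + 1) ≤ κ := by
    rw [← le_div_iff₀ ht]; exact min_le_right _ _
  have hFp := hη (x := t + κ) (by
    rw [Real.dist_eq, add_sub_cancel_left, abs_of_pos hκ]; simp only [κ]; linarith)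
  have hFm := hη (x := t - κ) (by
    rw [Real.dist_eq, sub_sub_cancel_left, abs_neg, abs_of_pos hκ]; simp only [κ]; linarith)
  filter_upwards [Metric.tendsto_nhds.1 (hW (t + κ)) (ε / 4) (by linarith),
    Metric.tendsto_nhds.1 (hW (t - κ)) (ε / 4) (by linarith), hU η hη1 (ε / 4) (by linarith)]
    with n h1 h2 h3
  set bad := {ω | ¬ ∃ q r : ℝ, |q - 1| ≤ η ∧ |r| ≤ η ∧ W n ω + r = q * U n ω}
  have hkey : ∀ q r : ℝ, |q - 1| ≤ η → |r| ≤ η → 0 < q ∧ |q * t - r - t| ≤ κ := by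
    intro q r hq hr
    refine ⟨by linarith [(abs_le.1 hq).1], ?_⟩
    calc |q * t - r - t| = |(q - 1) * t - r| := by ring_nf
      _ ≤ |(q - 1) * t| + |r| := abs_sub _ _
      _ ≤ η * |t| + η := by rw [abs_mul]; gcongr
      _ ≤ κ := by linarith
  have hs1 : {ω | U n ω ≤ t} ⊆ {ω | W n ω ≤ t + κ} ∪ bad := by
    intro ω hω
    by_cases hb : ω ∈ bad
    · exact Or.inr hb
    · obtain ⟨q, r, hq, hr, he⟩ := not_not.1 hb
      obtain ⟨hq0, h4⟩ := hkey q r hq hr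
      have h5 : q * U n ω ≤ q * t := mul_le_mul_of_nonneg_left hω hq0.le
      left
      change W n ω ≤ t + κ
      linarith [(abs_le.1 h4).2]
  have hs2 : {ω | W n ω ≤ t - κ} ⊆ {ω | U n ω ≤ t} ∪ bad := by
    intro ω hω
    by_cases hb : ω ∈ bad
    · exact Or.inr hb
    · obtain ⟨q, r, hq, hr, he⟩ := not_not.1 hb
      obtain ⟨hq0, h4⟩ := hkey q r hq hr
      have h5 : W n ω ≤ t - κ := hω
      left
      exact le_of_mul_le_mul_left (by linarith [(abs_le.1 h4).1]) hq0
  have h6 := (measureReal_mono (μ := P n) hs1).trans (measureReal_union_le _ _)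
  have h7 := (measureReal_mono (μ := P n) hs2).trans (measureReal_union_le _ _)
  rw [Real.dist_eq, abs_lt] at *
  constructor <;> linarith [h1.1, h1.2, h2.1, h2.2, hFp.1, hFp.2, hFm.1, hFm.2]

end CentralLimit

/-! ### Restricted eigenvalues and the ℓ₁ cone. -/

section LinearAlgebra

variable {d : ℕ}

lemma l1_nonneg (v : Fin d → ℝ) : 0 ≤ l1 v := Finset.sum_nonneg fun _ _ => abs_nonneg _

lemma abs_le_l1 (v : Fin d → ℝ) (j : Fin d) : |v j| ≤ l1 v :=
  Finset.single_le_sum (f := fun j => |v j|) (fun _ _ => abs_nonneg _) (Finset.mem_univ j)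

lemma l1_le_add (v w : Fin d → ℝ) : l1 v ≤ l1 w + l1 (v - w) := by
  unfold l1
  rw [← Finset.sum_add_distrib]
  refine Finset.sum_le_sum fun j _ => ?_
  have := abs_add_le (w j) (v j - w j)
  simpa using this

lemma abs_dotProduct_le (v w : Fin d → ℝ) : |v ⬝ᵥ w| ≤ l1 v * ‖w‖ := by
  unfold l1 dotProduct
  rw [Finset.sum_mul]
  refine (Finset.abs_sum_le_sum_abs _ _).trans (Finset.sum_le_sum fun j _ => ?_)
  rw [abs_mul]
  exact mul_le_mul_of_nonneg_left (norm_le_pi_norm w j) (abs_nonneg _)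

lemma norm_mulVec_le {M : Matrix (Fin d) (Fin d) ℝ} {τ : ℝ} (hτ : 0 ≤ τ)
    (hM : ∀ j k, |M j k| ≤ τ) (b : Fin d → ℝ) : ‖M *ᵥ b‖ ≤ τ * l1 b := by
  refine (pi_norm_le_iff_of_nonneg (mul_nonneg hτ (l1_nonneg b))).2 fun j => ?_
  rw [mulVec, dotProduct, l1, Finset.mul_sum, Real.norm_eq_abs]
  refine (Finset.abs_sum_le_sum_abs _ _).trans (Finset.sum_le_sum fun k _ => ?_)
  rw [abs_mul]
  exact mul_le_mul_of_nonneg_right (hM j k) (abs_nonneg _)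

/-- Restricted eigenvalue bound: if `M` is entrywise close to a matrix with smallest eigenvalue at
least `δ`, then `‖x‖₁` is controlled by `‖M x‖_∞` on the cone `‖x‖₁ ≤ 2 ‖x_T‖₁`. -/
lemma mul_l1_le_of_cone {S M : Matrix (Fin d) (Fin d) ℝ} {δ τ : ℝ} (hδ : 0 < δ) (hτ : 0 ≤ τ)
    (hS : ∀ x : Fin d → ℝ, δ * ∑ j, x j ^ 2 ≤ x ⬝ᵥ (S *ᵥ x))
    (hM : ∀ j k, |(M - S) j k| ≤ τ) (T : Finset (Fin d)) (hT : 8 * T.card * τ ≤ δ)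
    {x : Fin d → ℝ} (hx : l1 x ≤ 2 * ∑ j ∈ T, |x j|) :
    δ * l1 x ≤ 8 * T.card * ‖M *ᵥ x‖ := by
  set Q := ∑ j, x j ^ 2
  have hQ0 : 0 ≤ Q := Finset.sum_nonneg fun _ _ => sq_nonneg _
  have h0 := l1_nonneg x
  have h1 : l1 x ^ 2 ≤ 4 * T.card * Q := by
    have h2 : (∑ j ∈ T, |x j|) ^ 2 ≤ T.card * ∑ j ∈ T, |x j| ^ 2 :=
      sq_sum_le_card_mul_sum_sq
    have h3 : ∑ j ∈ T, |x j| ^ 2 ≤ Q := by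
      simp only [sq_abs]
      exact Finset.sum_le_univ_sum_of_nonneg fun _ => sq_nonneg _
    have h4 : (T.card : ℝ) * ∑ j ∈ T, |x j| ^ 2 ≤ T.card * Q := by gcongr
    nlinarith
  have h5 : x ⬝ᵥ (M *ᵥ x) = x ⬝ᵥ (S *ᵥ x) + x ⬝ᵥ ((M - S) *ᵥ x) := by
    rw [← dotProduct_add, ← add_mulVec, add_sub_cancel]
  have h6 : |x ⬝ᵥ ((M - S) *ᵥ x)| ≤ τ * l1 x ^ 2 := by
    refine (abs_dotProduct_le _ _).trans ?_
    have := mul_le_mul_of_nonneg_left (norm_mulVec_le hτ hM x) h0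
    linarith
  -- On the cone the perturbation is at most τ‖x‖₁² ≤ 4|T|τQ ≤ δQ/2, so half of the eigenvalue bound
  -- survives.
  have h7 : δ / 2 * Q ≤ x ⬝ᵥ (M *ᵥ x) := by
    have h8 := hS x
    have h9 : τ * l1 x ^ 2 ≤ τ * (4 * T.card * Q) := by gcongr
    have h10 : 8 * T.card * τ * Q ≤ δ * Q := by gcongr
    rw [h5]
    linarith [(abs_le.1 h6).1]
  have h11 : x ⬝ᵥ (M *ᵥ x) ≤ l1 x * ‖M *ᵥ x‖ := (le_abs_self _).trans (abs_dotProduct_le _ _)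
  rcases h0.eq_or_lt with h | h
  · rw [← h, mul_zero]; positivity
  · refine le_of_mul_le_mul_left ?_ h
    have h12 : δ * l1 x ^ 2 ≤ δ * (4 * T.card * Q) := by gcongr
    have h13 : (8 * T.card) * (δ / 2 * Q) ≤ (8 * T.card) * (l1 x * ‖M *ᵥ x‖) := by
      exact mul_le_mul_of_nonneg_left (h7.trans h11) (by positivity)
    linarith

/-- Off the support of b the difference c - b is c itself. As c has no larger ℓ₁ norm than b, its
mass there is at most what it loses on the support, hence at most the mass of c - b on the support.
-/
lemma l1_sub_le_of_l1_le {b c : Fin d → ℝ} (h : l1 c ≤ l1 b) :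
    l1 (c - b) ≤ 2 * ∑ j ∈ Finset.univ.filter (fun j => b j ≠ 0), |(c - b) j| := by
  have hs : ∀ f : Fin d → ℝ, ∑ j, f j = ∑ j ∈ Finset.univ.filter (fun j => b j ≠ 0), f j +
      ∑ j ∈ Finset.univ.filter (fun j => ¬ b j ≠ 0), f j :=
    fun f => (Finset.sum_filter_add_sum_filter_not _ _ _).symm
  unfold l1 at h ⊢
  rw [hs fun j => |c j|, hs fun j => |b j|] at h
  rw [hs fun j => |(c - b) j|]
  have h1 : ∑ j ∈ Finset.univ.filter (fun j => ¬ b j ≠ 0), |b j| = 0 :=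
    Finset.sum_eq_zero fun j hj => by
      have : b j = 0 := not_not.1 (Finset.mem_filter.1 hj).2
      simp [this]
  have h2 : ∑ j ∈ Finset.univ.filter (fun j => ¬ b j ≠ 0), |(c - b) j| =
      ∑ j ∈ Finset.univ.filter (fun j => ¬ b j ≠ 0), |c j| :=
    Finset.sum_congr rfl fun j hj => by
      have : b j = 0 := not_not.1 (Finset.mem_filter.1 hj).2
      simp [this]
  have h3 : ∑ j ∈ Finset.univ.filter (fun j => b j ≠ 0), |b j| ≤
      ∑ j ∈ Finset.univ.filter (fun j => b j ≠ 0), |c j| +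
      ∑ j ∈ Finset.univ.filter (fun j => b j ≠ 0), |(c - b) j| := by
    rw [← Finset.sum_add_distrib]
    refine Finset.sum_le_sum fun j _ => ?_
    have := abs_sub (c j) ((c - b) j)
    simpa using this
  linarith

lemma card_support_eq_l0 (b : Fin d → ℝ) :
    (Finset.univ.filter (fun j => b j ≠ 0)).card = l0 b := by
  rw [l0, ← Set.ncard_coe_finset]
  congr 1; ext j; simp

/-- For the full index set the cone condition is automatic, so the restricted eigenvalue bound is
injectivity. It supplies feasible points in bounded dimension, where the target itself may fail to
be feasible. -/
lemma exists_mulVec_eq {S M : Matrix (Fin d) (Fin d) ℝ} {δ τ : ℝ} (hδ : 0 < δ) (hτ : 0 ≤ τ)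
    (hS : ∀ x : Fin d → ℝ, δ * ∑ j, x j ^ 2 ≤ x ⬝ᵥ (S *ᵥ x))
    (hM : ∀ j k, |(M - S) j k| ≤ τ) (hd : 8 * d * τ ≤ δ) (y : Fin d → ℝ) :
    ∃ x, M *ᵥ x = y := by
  have hinj : Function.Injective M.mulVecLin := by
    rw [← LinearMap.ker_eq_bot, LinearMap.ker_eq_bot']
    intro x hx
    have h := mul_l1_le_of_cone hδ hτ hS hM Finset.univ (by simpa using hd) (x := x)
      (by have := l1_nonneg x; unfold l1 at *; linarith)
    rw [mulVecLin_apply] at hx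
    rw [hx, norm_zero, mul_zero] at h
    have h1 : l1 x = 0 := le_antisymm (by nlinarith) (l1_nonneg x)
    ext j
    exact abs_eq_zero.1 (le_antisymm ((abs_le_l1 x j).trans h1.le) (abs_nonneg _))
  exact LinearMap.injective_iff_surjective.1 hinj y

end LinearAlgebra

/-! ### Deterministic analysis of the two programs and of the one-step estimator. -/

section Estimation

variable {n d : ℕ} {x : Fin n → Fin d → ℝ}

lemma sampleCov_comm (x : Fin n → Fin d → ℝ) (j k : Fin d) : sampleCov x j k = sampleCov x k j := by
  simp only [sampleCov_apply, mul_comm]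

lemma transpose_sampleCov (x : Fin n → Fin d → ℝ) : (sampleCov x)ᵀ = sampleCov x := by
  ext j k; exact sampleCov_comm x k j

lemma vecMul_sampleCov (x : Fin n → Fin d → ℝ) (v : Fin d → ℝ) :
    v ᵥ* sampleCov x = sampleCov x *ᵥ v := by
  rw [← vecMul_transpose, transpose_sampleCov]

/-- Symmetry of the sample covariance lets one error analysis serve both programs. -/
lemma vFeasible_eq [NeZero d] (x : Fin n → Fin d → ℝ) (lam : ℝ) :
    vFeasible x lam = betaFeasible x 0 lam := by
  simp only [vFeasible, betaFeasible, vecMul_sampleCov]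

/-- The `ℓ₁` error of a solution of the program, when the target is feasible and sparse or when the
sample covariance is invertible. -/
lemma l1_error_le_of_isL1Solution {S : Matrix (Fin d) (Fin d) ℝ} {δ τ lam L : ℝ} (hδ : 0 < δ)
    (hτ : 0 ≤ τ) (hlam : 0 ≤ lam)
    (hS : ∀ x : Fin d → ℝ, δ * ∑ j, x j ^ 2 ≤ x ⬝ᵥ (S *ᵥ x))
    (hM : ∀ j k, |(sampleCov x - S) j k| ≤ τ) {m : Fin d} {b c : Fin d → ℝ}
    (hb : S *ᵥ b = unitVec m) (hL : l1 b ≤ L) (hc : IsL1Solution (betaFeasible x m lam) c) {k : ℕ}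
    (hk : (k = l0 b ∧ ‖sampleCov x *ᵥ b - unitVec m‖ ≤ lam) ∨ k = d) (hkτ : 8 * k * τ ≤ δ) :
    ‖sampleCov x *ᵥ c - unitVec m‖ ≤ lam ∧ δ * l1 (c - b) ≤ 8 * k * (lam + τ * L) := by
  have hres : ‖sampleCov x *ᵥ b - unitVec m‖ ≤ τ * L := by
    rw [← hb, ← sub_mulVec]
    exact (norm_mulVec_le hτ hM b).trans (by gcongr)
  have hne : (betaFeasible x m lam).Nonempty := by
    rcases hk with ⟨-, h⟩ | rfl
    · exact ⟨b, h⟩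
    · obtain ⟨y, hy⟩ := exists_mulVec_eq hδ hτ hS hM hkτ (unitVec m)
      exact ⟨y, by simpa [betaFeasible, hy] using hlam⟩
  obtain ⟨hcF, hcmin⟩ := hc hne
  have hcF' : ‖sampleCov x *ᵥ c - unitVec m‖ ≤ lam := hcF
  refine ⟨hcF', ?_⟩
  have hdiff : ‖sampleCov x *ᵥ (c - b)‖ ≤ lam + τ * L := by
    have : sampleCov x *ᵥ (c - b) =
        (sampleCov x *ᵥ c - unitVec m) - (sampleCov x *ᵥ b - unitVec m) := by
      rw [mulVec_sub]; abel
    rw [this]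
    exact (norm_sub_le _ _).trans (add_le_add hcF' hres)
  have hfin : ∀ T : Finset (Fin d), T.card = k → l1 (c - b) ≤ 2 * ∑ j ∈ T, |(c - b) j| →
      δ * l1 (c - b) ≤ 8 * k * (lam + τ * L) := by
    intro T hT hcone
    have h := mul_l1_le_of_cone hδ hτ hS hM T (by rw [hT]; exact hkτ) hcone
    rw [hT] at h
    exact h.trans (by gcongr)
  rcases hk with ⟨hk, h⟩ | rfl
  · refine hfin _ ((card_support_eq_l0 b).trans hk.symm) (l1_sub_le_of_l1_le ?_)
    exact hcmin (show b ∈ betaFeasible x m lam from h)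
  · refine hfin Finset.univ (by simp) ?_
    have := l1_nonneg (c - b)
    unfold l1 at *
    linarith

lemma thetaTilde_expansion [NeZero d] {m : Fin d} {lam e ρ : ℝ} {v b vhat bhat : Fin d → ℝ}
    (hlam : lam < 1) (he : 0 ≤ e)
    (hv : ‖sampleCov x *ᵥ vhat - unitVec 0‖ ≤ lam) (hve : l1 (vhat - v) ≤ e)
    (hbe : l1 (bhat - b) ≤ e) (hb : ‖sampleCov x *ᵥ b - unitVec m‖ ≤ ρ) :
    ∃ c : ℝ, |c - 1| ≤ lam ∧
      |c * (thetaTilde x m vhat bhat - b 0) + v ⬝ᵥ (sampleCov x *ᵥ b - unitVec m)| ≤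
        2 * lam * e + e * ρ := by
  set M := sampleCov x
  set c := vhat ⬝ᵥ fun i => M i 0
  have hc : c = (M *ᵥ vhat) 0 := by
    simp only [c, mulVec, dotProduct_comm vhat]
    congr 1; ext i; exact sampleCov_comm x i 0
  have hc1 : |c - 1| ≤ lam := by
    have := (norm_le_pi_norm (M *ᵥ vhat - unitVec 0) 0).trans hv
    simpa [hc, unitVec] using this
  have hc0 : c ≠ 0 := by
    intro h
    rw [h] at hc1
    norm_num at hc1
    linarith
  refine ⟨c, hc1, ?_⟩
  have hsymm : ∀ w : Fin d → ℝ, vhat ⬝ᵥ (M *ᵥ w) = (M *ᵥ vhat) ⬝ᵥ w := by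
    intro w
    rw [dotProduct_mulVec, vecMul_sampleCov]
  -- The orthogonality behind the estimator: each term on the right is a product of two errors,
  -- bounded below by Hölder duality between ℓ₁ and the sup norm.
  have hid : c * (thetaTilde x m vhat bhat - b 0) + v ⬝ᵥ (M *ᵥ b - unitVec m) =
      (c - 1) * (bhat - b) 0 - (M *ᵥ vhat - unitVec 0) ⬝ᵥ (bhat - b) -
        (vhat - v) ⬝ᵥ (M *ᵥ b - unitVec m) := by
    have h1 : c * (thetaTilde x m vhat bhat - b 0) =
        c * (bhat 0 - b 0) - vhat ⬝ᵥ (M *ᵥ bhat - unitVec m) := by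
      simp only [thetaTilde]
      change c * (bhat 0 - (vhat ⬝ᵥ (M *ᵥ bhat - unitVec m)) / c - b 0) = _
      field_simp
      ring
    rw [h1]
    have h2 : (unitVec 0 : Fin d → ℝ) ⬝ᵥ (bhat - b) = bhat 0 - b 0 := by
      simp [unitVec]
    simp only [dotProduct_sub, sub_dotProduct, hsymm] at h2 ⊢
    simp only [Pi.sub_apply]
    linarith
  rw [hid]
  have hlam0 : 0 ≤ lam := (abs_nonneg _).trans hc1
  have e1 : |(c - 1) * (bhat - b) 0| ≤ lam * e := by
    rw [abs_mul]
    exact mul_le_mul hc1 ((abs_le_l1 _ _).trans hbe) (abs_nonneg _) hlam0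
  have e2 : |(M *ᵥ vhat - unitVec 0) ⬝ᵥ (bhat - b)| ≤ lam * e := by
    rw [dotProduct_comm]
    refine (abs_dotProduct_le _ _).trans ?_
    rw [mul_comm lam]
    exact mul_le_mul hbe hv (norm_nonneg _) he
  have e3 : |(vhat - v) ⬝ᵥ (M *ᵥ b - unitVec m)| ≤ e * ρ :=
    (abs_dotProduct_le _ _).trans (mul_le_mul hve hb (norm_nonneg _) he)
  refine (abs_sub _ _).trans ?_
  have := abs_sub ((c - 1) * (bhat - b) 0) ((M *ᵥ vhat - unitVec 0) ⬝ᵥ (bhat - b))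
  linarith

lemma dotProduct_sampleCov_mulVec (x : Fin n → Fin d → ℝ) (v b : Fin d → ℝ) :
    v ⬝ᵥ (sampleCov x *ᵥ b) = (n : ℝ)⁻¹ * ∑ i, (v ⬝ᵥ x i) * (b ⬝ᵥ x i) := by
  have h : ∀ i, (v ⬝ᵥ x i) * (b ⬝ᵥ x i) = v ⬝ᵥ (outer (x i) *ᵥ b) := fun i =>
    (bilin_outer v b (x i)).symm
  simp_rw [h]
  rw [sampleCov, smul_mulVec, dotProduct_smul, smul_eq_mul, sum_mulVec, dotProduct_sum]

lemma deltaHat_eq (hn : 0 < n) (x : Fin n → Fin d → ℝ) (v b : Fin d → ℝ) :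
    deltaHat x v b = (n : ℝ)⁻¹ * ∑ i, bilin v (outer (x i)) b ^ 2 -
      (v ⬝ᵥ (sampleCov x *ᵥ b)) ^ 2 := by
  have hn' : (n : ℝ) ≠ 0 := by positivity
  have h1 : ∀ i, bilin v (outer (x i) - sampleCov x) b =
      bilin v (outer (x i)) b - v ⬝ᵥ (sampleCov x *ᵥ b) := fun i => by
    simp [bilin, sub_mulVec, dotProduct_sub]
  have h2 : ∑ i, bilin v (outer (x i)) b = n * v ⬝ᵥ (sampleCov x *ᵥ b) := by
    rw [dotProduct_sampleCov_mulVec]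
    simp_rw [bilin_outer]
    field_simp
  simp only [deltaHat, h1, sub_sq, Finset.sum_add_distrib, Finset.sum_sub_distrib,
    ← Finset.sum_mul, ← Finset.mul_sum, h2]
  simp
  field_simp
  ring

/-- The difference of products is split so that each summand has one error factor, at most e√B in
absolute value, and one factor whose mean square is a quadratic form in the sample covariance. Such
forms are controlled by sup-norm residuals and ℓ₁ norms. -/
lemma mean_bilin_sub_sq_le {v b vhat bhat : Fin d → ℝ} {e B : ℝ} (hB0 : 0 ≤ B)
    (hB : ∀ i j, x i j ^ 2 ≤ B) (he : 0 ≤ e) (hve : l1 (vhat - v) ≤ e)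
    (hbe : l1 (bhat - b) ≤ e) :
    (n : ℝ)⁻¹ * ∑ i, (bilin vhat (outer (x i)) bhat - bilin v (outer (x i)) b) ^ 2 ≤
      2 * e ^ 2 * B * (bhat ⬝ᵥ (sampleCov x *ᵥ bhat) + v ⬝ᵥ (sampleCov x *ᵥ v)) := by
  have hlin : ∀ w : Fin d → ℝ, l1 w ≤ e → ∀ i, (w ⬝ᵥ x i) ^ 2 ≤ e ^ 2 * B := by
    intro w hw i
    have hx : ‖x i‖ ≤ √B := (pi_norm_le_iff_of_nonneg (Real.sqrt_nonneg _)).2 fun j => by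
      rw [Real.norm_eq_abs, ← Real.sqrt_sq_eq_abs]
      exact Real.sqrt_le_sqrt (hB i j)
    have h1 : |w ⬝ᵥ x i| ≤ e * √B :=
      (abs_dotProduct_le _ _).trans (mul_le_mul hw hx (norm_nonneg _) he)
    calc (w ⬝ᵥ x i) ^ 2 = |w ⬝ᵥ x i| ^ 2 := (sq_abs _).symm
      _ ≤ (e * √B) ^ 2 := by gcongr
      _ = e ^ 2 * B := by rw [mul_pow, Real.sq_sqrt hB0]
  rw [dotProduct_sampleCov_mulVec, dotProduct_sampleCov_mulVec, ← mul_add, mul_left_comm,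
    ← Finset.sum_add_distrib, Finset.mul_sum _ _ (2 * e ^ 2 * B)]
  refine mul_le_mul_of_nonneg_left (Finset.sum_le_sum fun i _ => ?_) (by positivity)
  have h1 := hlin _ hve i
  have h2 := hlin _ hbe i
  simp only [bilin_outer]
  have h3 : (vhat ⬝ᵥ x i) * (bhat ⬝ᵥ x i) - (v ⬝ᵥ x i) * (b ⬝ᵥ x i) =
      ((vhat - v) ⬝ᵥ x i) * (bhat ⬝ᵥ x i) + (v ⬝ᵥ x i) * ((bhat - b) ⬝ᵥ x i) := by
    simp only [sub_dotProduct]; ring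
  rw [h3]
  have h4 := mul_le_mul_of_nonneg_right h1 (sq_nonneg (bhat ⬝ᵥ x i))
  have h5 := mul_le_mul_of_nonneg_right h2 (sq_nonneg (v ⬝ᵥ x i))
  have h6 := add_sq_le (a := ((vhat - v) ⬝ᵥ x i) * (bhat ⬝ᵥ x i))
    (b := (v ⬝ᵥ x i) * ((bhat - b) ⬝ᵥ x i))
  nlinarith

/-- z² - y² = (z - y)² + 2y(z - y), with Cauchy–Schwarz on the cross term. -/
lemma abs_mean_sq_sub_le (y z : Fin n → ℝ) :
    |(n : ℝ)⁻¹ * ∑ i, z i ^ 2 - (n : ℝ)⁻¹ * ∑ i, y i ^ 2| ≤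
      (n : ℝ)⁻¹ * ∑ i, (z i - y i) ^ 2 +
        2 * √(((n : ℝ)⁻¹ * ∑ i, y i ^ 2) * ((n : ℝ)⁻¹ * ∑ i, (z i - y i) ^ 2)) := by
  have h1 : (n : ℝ)⁻¹ * ∑ i, z i ^ 2 - (n : ℝ)⁻¹ * ∑ i, y i ^ 2 =
      (n : ℝ)⁻¹ * ∑ i, (z i - y i) ^ 2 + 2 * ((n : ℝ)⁻¹ * ∑ i, y i * (z i - y i)) := by
    rw [← mul_sub, ← Finset.sum_sub_distrib, mul_left_comm, ← mul_add, Finset.mul_sum _ _ (2 : ℝ),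
      ← Finset.sum_add_distrib]
    congr 1
    exact Finset.sum_congr rfl fun i _ => by ring
  have h2 : |(n : ℝ)⁻¹ * ∑ i, y i * (z i - y i)| ≤
      √(((n : ℝ)⁻¹ * ∑ i, y i ^ 2) * ((n : ℝ)⁻¹ * ∑ i, (z i - y i) ^ 2)) := by
    refine Real.abs_le_sqrt ?_
    have := Finset.sum_mul_sq_le_sq_mul_sq Finset.univ y fun i => z i - y i
    calc _ = (n : ℝ)⁻¹ ^ 2 * (∑ i, y i * (z i - y i)) ^ 2 := by rw [mul_pow]
      _ ≤ (n : ℝ)⁻¹ ^ 2 * ((∑ i, y i ^ 2) * ∑ i, (z i - y i) ^ 2) := by gcongr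
      _ = _ := by ring
  have h3 : 0 ≤ (n : ℝ)⁻¹ * ∑ i, (z i - y i) ^ 2 := by positivity
  rw [h1]
  refine (abs_add_le _ _).trans ?_
  rw [abs_mul 2, abs_of_nonneg h3, abs_two]
  gcongr

end Estimation

/-! ### The population covariance and its inverse. -/

section Population

variable {d : ℕ} {μ : Measure (Fin d → ℝ)}

lemma popCov_transpose : (popCov μ)ᵀ = popCov μ := by
  ext j k; simp only [popCov, transpose_apply, of_apply]; exact covariance_comm _ _

lemma popCov_isHermitian : (popCov μ).IsHermitian := by
  rw [Matrix.IsHermitian, conjTranspose_eq_transpose_of_trivial, popCov_transpose]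

lemma mul_sum_sq_le_of_spectrum {δ : ℝ} (h : ∀ κ ∈ spectrum ℝ (popCov μ), δ ≤ κ)
    (x : Fin d → ℝ) : δ * ∑ j, x j ^ 2 ≤ x ⬝ᵥ (popCov μ *ᵥ x) := by
  have hpsd : (popCov μ - δ • (1 : Matrix (Fin d) (Fin d) ℝ)).PosSemidef := by
    rw [posSemidef_iff_isHermitian_and_spectrum_nonneg]
    refine ⟨popCov_isHermitian.sub ?_, fun κ hκ => ?_⟩
    · rw [Matrix.IsHermitian, conjTranspose_eq_transpose_of_trivial]; simp
    · have h1 : κ + δ ∈ spectrum ℝ (popCov μ) := by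
        rw [← Algebra.algebraMap_eq_smul_one] at hκ
        have := spectrum.add_mem_add_iff (R := ℝ) (a := popCov μ - algebraMap ℝ _ δ)
          (r := κ) (s := δ)
        rw [add_sub_cancel] at this
        exact this.2 hκ
      change (0 : ℝ) ≤ κ
      linarith [h _ h1]
  have h2 := hpsd.dotProduct_mulVec_nonneg x
  have h3 : x ⬝ᵥ x = ∑ j, x j ^ 2 := by simp [dotProduct, sq]
  simp only [star_trivial, sub_mulVec, smul_mulVec, one_mulVec, dotProduct_sub, dotProduct_smul,
    smul_eq_mul, h3] at h2
  linarith

variable {δ : ℝ} (hδ : 0 < δ) (hS : ∀ x : Fin d → ℝ, δ * ∑ j, x j ^ 2 ≤ x ⬝ᵥ (popCov μ *ᵥ x))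

include hδ hS in
lemma popCov_mulVec_precisionCol (j : Fin d) : popCov μ *ᵥ precisionCol μ j = unitVec j := by
  have hinj : Function.Injective (popCov μ).mulVec := by
    have : Function.Injective (popCov μ).mulVecLin := by
      rw [← LinearMap.ker_eq_bot, LinearMap.ker_eq_bot']
      intro x hx
      rw [mulVecLin_apply] at hx
      have h := hS x
      rw [hx, dotProduct_zero] at h
      have h0 : ∑ j, x j ^ 2 = 0 := le_antisymm (by nlinarith) (by positivity)
      ext k
      exact pow_eq_zero_iff two_ne_zero |>.1
        ((Finset.sum_eq_zero_iff_of_nonneg fun _ _ => sq_nonneg _).1 h0 k (Finset.mem_univ k))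
    exact this
  have hu : IsUnit (popCov μ).det :=
    (Matrix.isUnit_iff_isUnit_det _).1 (mulVec_injective_iff_isUnit.1 hinj)
  have h1 : precisionCol μ j = (popCov μ)⁻¹ *ᵥ Pi.single j 1 := by
    ext i; simp [precisionCol, precision]
  rw [h1, mulVec_mulVec, mul_nonsing_inv _ hu, one_mulVec, unitVec]

lemma precision_comm (j k : Fin d) : precision μ j k = precision μ k j := by
  have : (precision μ)ᵀ = precision μ := by
    rw [precision, transpose_nonsing_inv, popCov_transpose]
  rw [← this, transpose_apply, this]

lemma one_le_l0_of_mulVec_eq {S : Matrix (Fin d) (Fin d) ℝ} {b : Fin d → ℝ} {m : Fin d}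
    (hb : S *ᵥ b = unitVec m) : 1 ≤ l0 b := by
  rw [← card_support_eq_l0, Nat.one_le_iff_ne_zero, Finset.card_ne_zero]
  by_contra hne
  have hb0 : b = 0 := by
    ext j
    by_contra hj
    exact hne ⟨j, by simpa using hj⟩
  have := congrFun hb m
  simp [hb0, unitVec] at this

lemma l0_le (b : Fin d → ℝ) : l0 b ≤ d := by
  rw [← card_support_eq_l0]
  exact (Finset.card_le_univ _).trans (by simp)

include hδ hS in
/-- The diagonal entries of the precision matrix are bounded below. -/
lemma inv_le_of_mulVec_eq {b : Fin d → ℝ} {m : Fin d} {G : ℝ} (hG : 0 < G)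
    (hb : popCov μ *ᵥ b = unitVec m) (hm : popCov μ m m ≤ G) : G⁻¹ ≤ b m := by
  -- Nonnegativity of the quadratic form at b - e_m/G reads b_m - 2/G + Σ_mm/G² ≥ 0, and Σ_mm ≤ G.
  have h := (mul_nonneg hδ.le (Finset.sum_nonneg fun j _ => sq_nonneg _)).trans
    (hS (b - G⁻¹ • unitVec m))
  have h1 : (unitVec m : Fin d → ℝ) ⬝ᵥ unitVec m = 1 := by simp [unitVec]
  have h2 : (unitVec m : Fin d → ℝ) ⬝ᵥ (popCov μ *ᵥ unitVec m) = popCov μ m m := by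
    simp [unitVec]
  have h3 : b ⬝ᵥ (popCov μ *ᵥ unitVec m) = 1 := by
    rw [dotProduct_mulVec, ← mulVec_transpose, popCov_transpose, hb, h1]
  have h4 : b ⬝ᵥ unitVec m = b m := by simp [unitVec]
  simp only [mulVec_sub, mulVec_smul, dotProduct_sub, sub_dotProduct, dotProduct_smul,
    smul_dotProduct, smul_eq_mul, hb, h1, h2, h3, h4] at h
  have h5 : G⁻¹ * (G⁻¹ * popCov μ m m) ≤ G⁻¹ * (G⁻¹ * G) := by gcongr
  rw [inv_mul_cancel₀ hG.ne'] at h5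
  linarith

lemma sq_le_l2_sq (b : Fin d → ℝ) (m : Fin d) : b m ^ 2 ≤ l2 b ^ 2 := by
  rw [l2, Real.sq_sqrt (by positivity)]
  exact Finset.single_le_sum (f := fun j => b j ^ 2) (fun _ _ => sq_nonneg _) (Finset.mem_univ m)

end Population

/-! ### Moments of the standardized summands. -/

section Standardized

variable {E : Type*} [MeasurableSpace E] {μ : Measure E} [IsProbabilityMeasure μ] {Y : E → ℝ}
  {θ C₄ C₁ D : ℝ}

/-- The minus sign matches the leading term of θ̃ - θ*. The variance floor `D` is what makes the
fourth moment bound uniform in n. -/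
lemma standardized_moments (hY : Measurable Y) (hi : Integrable (fun x => Y x ^ 4) μ)
    (h4 : ∫ x, Y x ^ 4 ∂μ ≤ C₄) (hθ : ∫ x, Y x ∂μ = θ) (hθ1 : |θ| ≤ C₁) (hD : 0 < D)
    (hvar : D ≤ variance Y μ) :
    ∫ x, -(Y x - θ) / √(variance Y μ) ∂μ = 0 ∧
    ∫ x, (-(Y x - θ) / √(variance Y μ)) ^ 2 ∂μ = 1 ∧
    Integrable (fun x => (-(Y x - θ) / √(variance Y μ)) ^ 4) μ ∧
    ∫ x, (-(Y x - θ) / √(variance Y μ)) ^ 4 ∂μ ≤ 8 * (C₄ + C₁ ^ 4) / D ^ 2 := by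
  have hm := memLp_four_of_integrable_pow hY.aestronglyMeasurable hi
  have hYi : Integrable Y μ := hm.integrable (by norm_num)
  have hpos : 0 < variance Y μ := hD.trans_le hvar
  have hC1 : θ ^ 4 ≤ C₁ ^ 4 := by
    rw [← Even.pow_abs (by decide) θ]; gcongr
  have e4 : ∀ x, (-(Y x - θ) / √(variance Y μ)) ^ 4 = (Y x - θ) ^ 4 / variance Y μ ^ 2 := by
    intro x
    rw [div_pow, Even.neg_pow (by decide), show √(variance Y μ) ^ 4 = (√(variance Y μ) ^ 2) ^ 2 by
      ring, Real.sq_sqrt hpos.le]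
  have hb : ∀ x, (-(Y x - θ) / √(variance Y μ)) ^ 4 ≤ 8 * (Y x ^ 4 + C₁ ^ 4) / D ^ 2 := by
    intro x
    rw [e4]
    have h1 : (Y x - θ) ^ 4 ≤ 8 * (Y x ^ 4 + θ ^ 4) := by
      nlinarith [sq_nonneg (Y x + θ), sq_nonneg (Y x ^ 2 - θ ^ 2),
        sq_nonneg ((Y x + θ) * (Y x - θ)), sq_nonneg ((Y x + θ) ^ 2),
        sq_nonneg ((Y x - θ) ^ 2 - (Y x + θ) ^ 2), sq_nonneg (Y x * (Y x + θ)),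
        sq_nonneg (θ * (Y x + θ))]
    gcongr
    linarith
  have hbi : Integrable (fun x => 8 * (Y x ^ 4 + C₁ ^ 4) / D ^ 2) μ :=
    ((hi.add (integrable_const _)).const_mul 8).div_const _
  have hint : Integrable (fun x => (-(Y x - θ) / √(variance Y μ)) ^ 4) μ := by
    refine hbi.mono' (by fun_prop) (ae_of_all _ fun x => ?_)
    rw [Real.norm_of_nonneg (by positivity)]
    exact hb x
  refine ⟨?_, ?_, hint, ?_⟩
  · rw [integral_div, integral_neg, integral_sub hYi (integrable_const _), hθ]
    simp
  · simp only [div_pow, neg_sq, Real.sq_sqrt hpos.le]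
    rw [integral_div, ← hθ, ← variance_eq_integral hY.aemeasurable, div_self hpos.ne']
  · refine (integral_mono hint hbi hb).trans ?_
    rw [integral_div, integral_const_mul, integral_add hi (integrable_const _)]
    simp only [integral_const, probReal_univ, one_smul]
    gcongr

end Standardized

/-! ### Consistency of the variance estimator and the perturbation of the studentized statistic. -/

section Studentized

lemma dotProduct_unitVec {d : ℕ} (v : Fin d → ℝ) (m : Fin d) : v ⬝ᵥ unitVec m = v m := by
  simp [unitVec]

lemma norm_unitVec_le {d : ℕ} (m : Fin d) : ‖(unitVec m : Fin d → ℝ)‖ ≤ 1 := by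
  refine (pi_norm_le_iff_of_nonneg zero_le_one).2 fun j => ?_
  by_cases h : j = m
  · subst h; simp [unitVec]
  · simp [unitVec, h]

variable {n d : ℕ} [NeZero d] {x : Fin n → Fin d → ℝ}

/-- The bound on the error of the variance estimator. -/
noncomputable def varianceError (L G ε e lam B : ℝ) : ℝ :=
  ε + 2 * e ^ 2 * B * (4 * L + 2) + 2 * √((G + ε) * (2 * e ^ 2 * B * (4 * L + 2))) +
    ((L + 1) * lam + e) * ((L + 1) * lam + e + 2 * L)

/-- Δ̂ is a mean of squares minus a squared mean. Three errors add up: estimated against true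
vectors in the squares, empirical against population second moment, and v̂ᵀΣ_nβ̂ against θ*. The
last is small because v̂ᵀΣ_nβ̂ ≈ v̂_m ≈ v_m = b_0. -/
lemma abs_deltaHat_sub_le (hn : 0 < n) {m : Fin d} {lam e ρ L G ε B : ℝ} {G₂ : ℝ}
    {v b vhat bhat : Fin d → ℝ}
    (hlam1 : lam ≤ 1) (he : 0 ≤ e) (he1 : e ≤ 1) (hL : 0 ≤ L) (hρ : ρ ≤ 1) (hB0 : 0 ≤ B)
    (hbL : l1 b ≤ L) (hvL : l1 v ≤ L) (hvm : v m = b 0)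
    (hbh : ‖sampleCov x *ᵥ bhat - unitVec m‖ ≤ lam)
    (hv : ‖sampleCov x *ᵥ v - unitVec 0‖ ≤ ρ)
    (hve : l1 (vhat - v) ≤ e) (hbe : l1 (bhat - b) ≤ e) (hB : ∀ i j, x i j ^ 2 ≤ B)
    (hG : G₂ ≤ G)
    (hε : |(n : ℝ)⁻¹ * ∑ i, bilin v (outer (x i)) b ^ 2 - G₂| ≤ ε) :
    |deltaHat x vhat bhat - (G₂ - b 0 ^ 2)| ≤ varianceError L G ε e lam B := by
  have hlam0 : 0 ≤ lam := (norm_nonneg _).trans hbh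
  have hbhL : l1 bhat ≤ L + 1 := (l1_le_add bhat b).trans (by linarith)
  have hvhL : l1 vhat ≤ L + 1 := (l1_le_add vhat v).trans (by linarith)
  have hnorm : ∀ (w : Fin d → ℝ) (k : Fin d) (r : ℝ), ‖sampleCov x *ᵥ w - unitVec k‖ ≤ r →
      r ≤ 1 → ‖sampleCov x *ᵥ w‖ ≤ 2 := by
    intro w k r h hr
    have := norm_add_le (sampleCov x *ᵥ w - unitVec k) (unitVec k)
    rw [sub_add_cancel] at this
    linarith [norm_unitVec_le k]
  have hq1 : bhat ⬝ᵥ (sampleCov x *ᵥ bhat) ≤ (L + 1) * 2 :=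
    (le_abs_self _).trans ((abs_dotProduct_le _ _).trans
      (mul_le_mul hbhL (hnorm _ _ _ hbh hlam1) (norm_nonneg _) (by linarith)))
  have hq2 : v ⬝ᵥ (sampleCov x *ᵥ v) ≤ L * 2 :=
    (le_abs_self _).trans ((abs_dotProduct_le _ _).trans
      (mul_le_mul hvL (hnorm _ _ _ hv hρ) (norm_nonneg _) hL))
  have hζ : (n : ℝ)⁻¹ * ∑ i, (bilin vhat (outer (x i)) bhat - bilin v (outer (x i)) b) ^ 2 ≤
      2 * e ^ 2 * B * (4 * L + 2) := by
    refine (mean_bilin_sub_sq_le hB0 hB he hve hbe).trans ?_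
    exact mul_le_mul_of_nonneg_left (by linarith) (by positivity)
  set A₀ := (n : ℝ)⁻¹ * ∑ i, bilin v (outer (x i)) b ^ 2
  set A₁ := (n : ℝ)⁻¹ * ∑ i, bilin vhat (outer (x i)) bhat ^ 2
  set ζ := 2 * e ^ 2 * B * (4 * L + 2)
  have hA₀ : A₀ ≤ G + ε := by linarith [(abs_le.1 hε).2]
  have hA : |A₁ - A₀| ≤ ζ + 2 * √((G + ε) * ζ) := by
    refine (abs_mean_sq_sub_le _ _).trans ?_
    have hA₀0 : 0 ≤ A₀ := by positivity
    gcongr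
    exact hA₀0.trans hA₀
  set μ' := vhat ⬝ᵥ (sampleCov x *ᵥ bhat)
  have hmean : |μ' - b 0| ≤ (L + 1) * lam + e := by
    have h1 : μ' - b 0 = vhat ⬝ᵥ (sampleCov x *ᵥ bhat - unitVec m) + (vhat - v) m := by
      rw [dotProduct_sub, dotProduct_unitVec, Pi.sub_apply, hvm]; ring
    rw [h1]
    refine (abs_add_le _ _).trans (add_le_add ((abs_dotProduct_le _ _).trans ?_)
      ((abs_le_l1 _ _).trans hve))
    exact mul_le_mul hvhL hbh (norm_nonneg _) (by linarith)
  have hmean2 : |μ' ^ 2 - b 0 ^ 2| ≤ ((L + 1) * lam + e) * ((L + 1) * lam + e + 2 * L) := by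
    have h1 : μ' ^ 2 - b 0 ^ 2 = (μ' - b 0) * (μ' - b 0 + 2 * b 0) := by ring
    rw [h1, abs_mul]
    refine mul_le_mul hmean ?_ (abs_nonneg _) (by positivity)
    refine (abs_add_le _ _).trans (add_le_add hmean ?_)
    rw [abs_mul, abs_two]
    linarith [(abs_le_l1 b 0).trans hbL]
  rw [deltaHat_eq hn, varianceError]
  have h1 : A₁ - μ' ^ 2 - (G₂ - b 0 ^ 2) = (A₁ - A₀) + (A₀ - G₂) - (μ' ^ 2 - b 0 ^ 2) := by ring
  change |A₁ - μ' ^ 2 - (G₂ - b 0 ^ 2)| ≤ _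
  rw [h1]
  have h2 := abs_sub ((A₁ - A₀) + (A₀ - G₂)) (μ' ^ 2 - b 0 ^ 2)
  have h3 := abs_add_le (A₁ - A₀) (A₀ - G₂)
  linarith

lemma abs_sqrt_sub_one_le {y : ℝ} (hy : 0 ≤ y) : |√y - 1| ≤ |y - 1| := by
  have h : y - 1 = (√y - 1) * (√y + 1) := by nlinarith [Real.sq_sqrt hy]
  rw [h, abs_mul]
  refine le_mul_of_one_le_right (abs_nonneg _) ?_
  rw [abs_of_nonneg (by positivity)]
  linarith [Real.sqrt_nonneg y]

/-- The studentized estimator is a perturbation of a standardized sum. -/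
lemma exists_studentized_decomposition (hn : 0 < n) {m : Fin d} {lam e ρ L G ε B η D G₂ : ℝ}
    {v b vhat bhat : Fin d → ℝ} (hη : 0 < η) (hD : 0 < D)
    (hlam1 : lam < 1) (he : 0 ≤ e) (he1 : e ≤ 1) (hL : 0 ≤ L) (hρ : ρ ≤ 1) (hB0 : 0 ≤ B)
    (hbL : l1 b ≤ L) (hvL : l1 v ≤ L) (hvm : v m = b 0)
    (hbh : ‖sampleCov x *ᵥ bhat - unitVec m‖ ≤ lam)
    (hvh : ‖sampleCov x *ᵥ vhat - unitVec 0‖ ≤ lam)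
    (hb : ‖sampleCov x *ᵥ b - unitVec m‖ ≤ ρ)
    (hv : ‖sampleCov x *ᵥ v - unitVec 0‖ ≤ ρ)
    (hve : l1 (vhat - v) ≤ e) (hbe : l1 (bhat - b) ≤ e) (hB : ∀ i j, x i j ^ 2 ≤ B)
    (hG : G₂ ≤ G) (hDG : D ≤ G₂ - b 0 ^ 2)
    (hε : |(n : ℝ)⁻¹ * ∑ i, bilin v (outer (x i)) b ^ 2 - G₂| ≤ ε)
    (hlamη : lam ≤ η / 4) (hvarη : varianceError L G ε e lam B ≤ min (1 / 2) (η / 4) * D)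
    (hrem : √(n : ℝ) * (2 * lam * e + e * ρ) ≤ η * √D) :
    ∃ q r : ℝ, |q - 1| ≤ η ∧ |r| ≤ η ∧
      (√(n : ℝ))⁻¹ * ∑ i, -(bilin v (outer (x i)) b - b 0) / √(G₂ - b 0 ^ 2) + r =
        q * studentized x m vhat bhat (b 0) := by
  set Δ := G₂ - b 0 ^ 2
  have hΔ : 0 < Δ := hD.trans_le hDG
  have hn' : (0 : ℝ) < n := by exact_mod_cast hn
  obtain ⟨c, hc, hexp⟩ := thetaTilde_expansion hlam1 he hvh hve hbe hb
  have hdel := abs_deltaHat_sub_le hn hlam1.le he he1 hL hρ hB0 hbL hvL hvm hbh hv hve hbe hB hG hε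
  change |deltaHat x vhat bhat - Δ| ≤ _ at hdel
  set Δ' := deltaHat x vhat bhat
  have hratio : |Δ' / Δ - 1| ≤ min (1 / 2) (η / 4) := by
    rw [div_sub_one hΔ.ne', abs_div, abs_of_pos hΔ, div_le_iff₀ hΔ]
    refine hdel.trans (hvarη.trans ?_)
    gcongr
  have hr1 := hratio.trans (min_le_left _ _)
  have hr2 := hratio.trans (min_le_right _ _)
  have hΔ' : 0 < Δ' := by
    have h1 : 0 < Δ' / Δ := by linarith [(abs_le.1 hr1).1]
    exact (div_pos_iff_of_pos_right hΔ).1 h1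
  have hsq := abs_sqrt_sub_one_le (div_pos hΔ' hΔ).le
  set R := c * (thetaTilde x m vhat bhat - b 0) + v ⬝ᵥ (sampleCov x *ᵥ b - unitVec m)
  -- q collects the two multiplicative errors, the normalization c and the ratio of standard
  -- deviations; r is the rescaled remainder of the expansion.
  refine ⟨c * √(Δ' / Δ), √(n : ℝ) * R / √Δ, ?_, ?_, ?_⟩
  · have h1 : c * √(Δ' / Δ) - 1 = (c - 1) * √(Δ' / Δ) + (√(Δ' / Δ) - 1) := by ring
    have h2 : √(Δ' / Δ) ≤ 2 := by linarith [(abs_le.1 (hsq.trans hr1)).2]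
    rw [h1]
    refine (abs_add_le _ _).trans ?_
    rw [abs_mul, abs_of_nonneg (Real.sqrt_nonneg (Δ' / Δ))]
    have h3 : |c - 1| * √(Δ' / Δ) ≤ η / 4 * 2 :=
      mul_le_mul (hc.trans hlamη) h2 (Real.sqrt_nonneg _) (by positivity)
    linarith [hsq.trans hr2]
  · rw [abs_div, abs_of_pos (Real.sqrt_pos.2 hΔ), div_le_iff₀ (Real.sqrt_pos.2 hΔ), abs_mul,
      abs_of_nonneg (Real.sqrt_nonneg _)]
    calc _ ≤ √(n : ℝ) * (2 * lam * e + e * ρ) := by gcongr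
      _ ≤ η * √D := hrem
      _ ≤ η * √Δ := by gcongr
  · have h1 : ∑ i, -(bilin v (outer (x i)) b - b 0) / √Δ =
        -(n * (v ⬝ᵥ (sampleCov x *ᵥ b - unitVec m))) / √Δ := by
      rw [← Finset.sum_div, Finset.sum_neg_distrib, Finset.sum_sub_distrib, dotProduct_sub,
        dotProduct_unitVec, hvm, dotProduct_sampleCov_mulVec]
      simp only [bilin_outer, Finset.sum_const, Finset.card_univ, Fintype.card_fin, nsmul_eq_mul]
      field_simp
    have h2 : (√(n : ℝ))⁻¹ * n = √(n : ℝ) := by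
      rw [inv_mul_eq_div]; exact Real.div_sqrt
    have h3 : √(Δ' / Δ) = √Δ' / √Δ := Real.sqrt_div hΔ'.le _
    have h4 : √Δ' ≠ 0 := (Real.sqrt_pos.2 hΔ').ne'
    have h5 : √Δ ≠ 0 := (Real.sqrt_pos.2 hΔ).ne'
    rw [h1, h3, studentized]
    change _ = c * (√Δ' / √Δ) * (√(n : ℝ) * (thetaTilde x m vhat bhat - b 0) / √Δ')
    have h6 : (√(n : ℝ))⁻¹ * (-(n * (v ⬝ᵥ (sampleCov x *ᵥ b - unitVec m))) / √Δ) =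
        -(((√(n : ℝ))⁻¹ * n) * (v ⬝ᵥ (sampleCov x *ᵥ b - unitVec m))) / √Δ := by ring
    rw [h6, h2]
    field_simp
    simp only [R]
    ring

end Studentized

/-! ### Asymptotic rates. -/

section Rates

lemma tendsto_zero_of_sq_le {f h : ℕ → ℝ} (hh : Tendsto h atTop (𝓝 0))
    (hf : ∀ᶠ n in atTop, f n ^ 2 ≤ h n) : Tendsto f atTop (𝓝 0) := by
  have h1 : Tendsto (fun n => √(h n)) atTop (𝓝 0) := by
    simpa [Function.comp_def] using (Real.continuous_sqrt.tendsto 0).comp hh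
  refine squeeze_zero_norm' ?_ h1
  filter_upwards [hf] with n hn
  exact Real.abs_le_sqrt hn

lemma one_le_log_of_three_le {y : ℝ} (hy : 3 ≤ y) : 1 ≤ Real.log y := by
  rw [Real.le_log_iff_exp_le (by linarith)]
  linarith [Real.exp_one_lt_d9]

variable {d : ℕ → ℕ} {σ : ℕ → ℝ}

/-- The rate `√((log d + 1) / n)`. -/
noncomputable def slowRate (n d : ℕ) : ℝ := √((Real.log d + 1) / n)

lemma slowRate_sq (n d : ℕ) : slowRate n d ^ 2 = (Real.log d + 1) / n := by
  rw [slowRate, Real.sq_sqrt]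
  have : 0 ≤ Real.log d := Real.log_natCast_nonneg d
  positivity

lemma rate_le_slowRate (n d : ℕ) : rate n d ≤ slowRate n d := by
  unfold rate slowRate
  gcongr
  linarith

/-- For d ≥ 2, log d + 1 ≤ 3 log d. For d = 1 the hypothesis is vacuous because log d = 0, but then
σ = 1 and the quantity is log n / n. -/
lemma tendsto_slow_of_tendsto (hd : ∀ n, 1 ≤ d n) (hσd : ∀ n, σ n ≤ d n) (hσ : ∀ n, 1 ≤ σ n)
    (h : Tendsto (fun n : ℕ => σ n ^ 2 * Real.log (d n) * Real.log ((n : ℝ) * d n) / n)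
      atTop (𝓝 0)) :
    Tendsto (fun n : ℕ => σ n ^ 2 * (Real.log (d n) + 1) * Real.log ((n : ℝ) * d n) / n)
      atTop (𝓝 0) := by
  have hlog : Tendsto (fun n : ℕ => Real.log (n : ℝ) / (n : ℝ)) atTop (𝓝 0) :=
    Real.isLittleO_log_id_atTop.tendsto_div_nhds_zero.comp tendsto_natCast_atTop_atTop
  have hsum := (h.const_mul 3).add hlog
  rw [mul_zero, add_zero] at hsum
  refine squeeze_zero' ?_ ?_ hsum
  · filter_upwards [eventually_ge_atTop 1] with n hn
    have h1 : 0 ≤ Real.log (d n) := Real.log_natCast_nonneg _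
    have h2 : 0 ≤ Real.log ((n : ℝ) * d n) := by
      rw [← Nat.cast_mul]; exact Real.log_natCast_nonneg _
    positivity
  · filter_upwards [eventually_ge_atTop 1] with n hn
    have h2 : 0 ≤ Real.log ((n : ℝ) * d n) := by
      rw [← Nat.cast_mul]; exact Real.log_natCast_nonneg _
    have h0 : 0 ≤ Real.log (n : ℝ) / n := div_nonneg (Real.log_natCast_nonneg _) (by positivity)
    rcases (hd n).eq_or_lt with h1 | h1
    · have hσ1 : σ n = 1 := le_antisymm (by have := hσd n; rw [← h1] at this; simpa using this)
        (hσ n)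
      rw [← h1, hσ1]
      simp
    · have h3 : 1 ≤ 2 * Real.log (d n) := by
        have h4 : Real.log 2 ≤ Real.log (d n) :=
          Real.log_le_log (by norm_num) (by exact_mod_cast h1)
        linarith [Real.log_two_gt_d9]
      have h5 : σ n ^ 2 * (Real.log (d n) + 1) * Real.log ((n : ℝ) * d n) / n ≤
          σ n ^ 2 * (3 * Real.log (d n)) * Real.log ((n : ℝ) * d n) / n := by
        gcongr
        linarith
      have h6 : σ n ^ 2 * (3 * Real.log (d n)) * Real.log ((n : ℝ) * d n) / n =
        3 * (σ n ^ 2 * Real.log (d n) * Real.log ((n : ℝ) * d n) / n) := by ring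
      linarith

/-- The four limits govern the sup-norm error, the ℓ₁ error, √n times the remainder, and the
variance error. They follow from log(nd) ≥ log d + 1, valid for n ≥ 3. -/
lemma tendsto_rates (hd : ∀ n, 1 ≤ d n) (hσ : ∀ n, 1 ≤ σ n)
    (h : Tendsto (fun n : ℕ => σ n ^ 2 * (Real.log (d n) + 1) * Real.log ((n : ℝ) * d n) / n)
      atTop (𝓝 0)) :
    Tendsto (fun n => slowRate n (d n)) atTop (𝓝 0) ∧
    Tendsto (fun n => σ n * slowRate n (d n)) atTop (𝓝 0) ∧
    Tendsto (fun n : ℕ => √(n : ℝ) * (slowRate n (d n) * (σ n * slowRate n (d n))))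
      atTop (𝓝 0) ∧
    Tendsto (fun n : ℕ => (σ n * slowRate n (d n)) ^ 2 * Real.log ((n : ℝ) * d n))
      atTop (𝓝 0) := by
  have hl : ∀ n, 0 ≤ Real.log (d n) := fun n => Real.log_natCast_nonneg _
  have hbig : ∀ᶠ n : ℕ in atTop, 0 < (n : ℝ) ∧ 1 ≤ Real.log ((n : ℝ) * d n) ∧
      Real.log (d n) + 1 ≤ Real.log ((n : ℝ) * d n) := by
    filter_upwards [eventually_ge_atTop 3] with n hn
    have hn' : (3 : ℝ) ≤ n := by exact_mod_cast hn
    have hdn : (1 : ℝ) ≤ d n := by exact_mod_cast hd n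
    have h1 := one_le_log_of_three_le hn'
    rw [Real.log_mul (by positivity) (by positivity)]
    exact ⟨by linarith, by linarith [hl n], by linarith⟩
  refine ⟨?_, ?_, ?_, ?_⟩
  · refine tendsto_zero_of_sq_le h ?_
    filter_upwards [hbig] with n ⟨hn, h1, h2⟩
    rw [slowRate_sq]
    gcongr
    have h3 : 1 ≤ σ n ^ 2 := one_le_pow₀ (hσ n)
    have h4 : 0 ≤ Real.log (d n) + 1 := by linarith [hl n]
    calc Real.log (d n) + 1 = 1 * (Real.log (d n) + 1) * 1 := by ring
      _ ≤ _ := by gcongr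
  · refine tendsto_zero_of_sq_le h ?_
    filter_upwards [hbig] with n ⟨hn, h1, h2⟩
    rw [mul_pow, slowRate_sq, ← mul_div_assoc]
    exact div_le_div_of_nonneg_right
      (le_mul_of_one_le_right (mul_nonneg (sq_nonneg _) (by linarith [hl n])) h1) hn.le
  · refine tendsto_zero_of_sq_le h ?_
    filter_upwards [hbig] with n ⟨hn, h1, h2⟩
    have h3 : (√(n : ℝ) * (slowRate n (d n) * (σ n * slowRate n (d n)))) ^ 2 =
        σ n ^ 2 * (Real.log (d n) + 1) * (Real.log (d n) + 1) / n := by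
      rw [show (√(n : ℝ) * (slowRate n (d n) * (σ n * slowRate n (d n)))) ^ 2 =
        √(n : ℝ) ^ 2 * (slowRate n (d n) ^ 2 * (σ n ^ 2 * slowRate n (d n) ^ 2)) by ring,
        slowRate_sq, Real.sq_sqrt hn.le]
      field_simp
    rw [h3]
    have h4 : 0 ≤ Real.log (d n) + 1 := by linarith [hl n]
    gcongr
  · refine h.congr fun n => ?_
    rw [mul_pow, slowRate_sq]
    ring

lemma tendsto_varianceError {e lam B : ℕ → ℝ} (L G ε : ℝ) (he : Tendsto e atTop (𝓝 0))
    (hlam : Tendsto lam atTop (𝓝 0)) (hB : Tendsto (fun n => e n ^ 2 * B n) atTop (𝓝 0)) :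
    Tendsto (fun n => varianceError L G ε (e n) (lam n) (B n)) atTop (𝓝 ε) := by
  have h1 : Tendsto (fun n => 2 * e n ^ 2 * B n * (4 * L + 2)) atTop (𝓝 0) := by
    have := (hB.const_mul 2).mul_const (4 * L + 2)
    simp only [mul_zero, zero_mul] at this
    exact this.congr fun n => by ring
  have h2 : Tendsto (fun n => √((G + ε) * (2 * e n ^ 2 * B n * (4 * L + 2)))) atTop (𝓝 0) := by
    have := (Real.continuous_sqrt.tendsto _).comp (h1.const_mul (G + ε))
    simpa [Function.comp_def] using this
  have h3 : Tendsto (fun n => (L + 1) * lam n + e n) atTop (𝓝 0) := by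
    simpa using (hlam.const_mul (L + 1)).add he
  have h4 : Tendsto (fun n => ((L + 1) * lam n + e n) * ((L + 1) * lam n + e n + 2 * L))
      atTop (𝓝 0) := by
    simpa using h3.mul (h3.add_const (2 * L))
  simpa [varianceError] using ((h1.const_add ε).add (h2.const_mul 2)).add h4

end Rates

/-! ### The ℓ₁ error in both dimension regimes. -/

section Good

variable {n d : ℕ} {x : Fin n → Fin d → ℝ}

/-- For d > D the finer bound `u` makes the target feasible and its sparsity is used; for d ≤ D all
d coordinates count as support. The factor D·σ dominates both. -/
lemma l1_error_le_of_good {S : Matrix (Fin d) (Fin d) ℝ} {δ τ u lam lamB L σ : ℝ} {D : ℕ}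
    (hδ : 0 < δ) (hτ : 0 ≤ τ) (hu0 : 0 ≤ u) (hD : 1 ≤ D) (hσ : 1 ≤ σ)
    (hS : ∀ x : Fin d → ℝ, δ * ∑ j, x j ^ 2 ≤ x ⬝ᵥ (S *ᵥ x))
    (hM : ∀ j k, |(sampleCov x - S) j k| ≤ τ)
    (hu : D < d → ∀ j k, |(sampleCov x - S) j k| ≤ u) {m : Fin d} {b c : Fin d → ℝ}
    (hb : S *ᵥ b = unitVec m) (hL0 : 0 ≤ L) (hL : l1 b ≤ L) (hs : (l0 b : ℝ) ≤ σ)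
    (hlam : u * l1 b ≤ lam) (hlamB : lam ≤ lamB)
    (hc : IsL1Solution (betaFeasible x m lam) c) (hsmall : 8 * (D * σ) * τ ≤ δ) :
    ‖sampleCov x *ᵥ c - unitVec m‖ ≤ lamB ∧
      l1 (c - b) ≤ 8 * (D * σ) * (lamB + τ * L) / δ := by
  have hlam0 : 0 ≤ lam := (mul_nonneg hu0 (l1_nonneg b)).trans hlam
  have hD' : (1 : ℝ) ≤ D := by exact_mod_cast hD
  obtain ⟨k, hk, hkσ⟩ : ∃ k : ℕ,
      ((k = l0 b ∧ ‖sampleCov x *ᵥ b - unitVec m‖ ≤ lam) ∨ k = d) ∧ (k : ℝ) ≤ D * σ := by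
    by_cases hDd : D < d
    · refine ⟨l0 b, Or.inl ⟨rfl, ?_⟩, hs.trans (le_mul_of_one_le_left (by linarith) hD')⟩
      rw [← hb, ← sub_mulVec]
      exact (norm_mulVec_le hu0 (hu hDd) b).trans hlam
    · refine ⟨d, Or.inr rfl, ?_⟩
      have : (d : ℝ) ≤ D := by exact_mod_cast not_lt.1 hDd
      exact this.trans (le_mul_of_one_le_right (by linarith) hσ)
  have hkτ : 8 * k * τ ≤ δ := by
    refine le_trans ?_ hsmall
    gcongr
  obtain ⟨h1, h2⟩ := l1_error_le_of_isL1Solution hδ hτ hlam0 hS hM hb hL hc hk hkτ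
  refine ⟨h1.trans hlamB, ?_⟩
  rw [le_div_iff₀ hδ, mul_comm]
  refine h2.trans ?_
  gcongr

end Good

/-! ### Probabilities of the exceptional events. -/

section SampleEvents

variable {Ω : Type*} [MeasurableSpace Ω] {P : Measure Ω}
  {n d : ℕ} {μ : Measure (Fin d → ℝ)} [IsProbabilityMeasure μ] {K : ℝ}
  {X : Fin n → Ω → (Fin d → ℝ)}

/-- The exponent is p(log d + 1): the logarithm pays for the d² entries since p ≥ 2, and the extra 1
leaves exp(-p), small uniformly in d. -/
lemma measureReal_sampleCov_sub_ge_slowRate_le [IsProbabilityMeasure P] (hn : 0 < n) (hd : 0 < d) (hK : 0 < K)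
    (h0 : ∀ j, ∫ x, x j ∂μ = 0)
    (h : ∀ j, psiNorm 2 (fun x : Fin d → ℝ => x j) μ ≤ ENNReal.ofReal K)
    (hX : ∀ i, HasLaw (X i) μ P) (hind : iIndepFun X P) {p : ℝ} (hp : 2 ≤ p)
    (hu : 8 * √p / expRate K * slowRate n d ≤ 16 / expRate K) :
    P.real {ω | ∃ j k, 8 * √p / expRate K * slowRate n d ≤
      |sampleCov (fun i => X i ω) j k - popCov μ j k|} ≤ 2 * Real.exp (-p) := by
  have ha := expRate_pos hK
  have hn' : (0 : ℝ) < n := by exact_mod_cast hn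
  have hd' : (0 : ℝ) < d := by exact_mod_cast hd
  have hl : 0 ≤ Real.log d := Real.log_natCast_nonneg d
  refine (measureReal_sampleCov_sub_ge_le hn hK h0 h hX hind
    (by unfold slowRate; positivity) hu).trans ?_
  have h1 : (n : ℝ) * (expRate K ^ 2 * (8 * √p / expRate K * slowRate n d) ^ 2 / 64) =
      p * (Real.log d + 1) := by
    rw [mul_pow, slowRate_sq, div_pow, mul_pow, Real.sq_sqrt (by linarith)]
    field_simp
    norm_num
  rw [h1]
  have h2 : Real.exp (-(p * (Real.log d + 1))) ≤ Real.exp (-p) * ((d : ℝ) ^ 2)⁻¹ := by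
    rw [← Real.exp_log (by positivity : (0 : ℝ) < ((d : ℝ) ^ 2)⁻¹), ← Real.exp_add]
    refine Real.exp_le_exp.2 ?_
    rw [Real.log_inv, Real.log_pow]
    push_cast
    nlinarith
  calc _ ≤ 2 * (d : ℝ) ^ 2 * (Real.exp (-p) * ((d : ℝ) ^ 2)⁻¹) := by gcongr
    _ = _ := by field_simp

/-- Source of the universal constant: 160 turns the Bernstein exponent into (25/e²) log d ≥ 3 log d,
and d²·d⁻³ leaves 1/d. The dependence on K cancels. -/
lemma measureReal_sampleCov_sub_ge_rate_le [IsProbabilityMeasure P] (hn : 0 < n) (hd : 0 < d) (hK : 0 < K)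
    (h0 : ∀ j, ∫ x, x j ∂μ = 0)
    (h : ∀ j, psiNorm 2 (fun x : Fin d → ℝ => x j) μ ≤ ENNReal.ofReal K)
    (hX : ∀ i, HasLaw (X i) μ P) (hind : iIndepFun X P)
    (hu : 160 * K ^ 2 * rate n d ≤ 16 / expRate K) :
    P.real {ω | ∃ j k, 160 * K ^ 2 * rate n d ≤
      |sampleCov (fun i => X i ω) j k - popCov μ j k|} ≤ 2 / d := by
  have hn' : (0 : ℝ) < n := by exact_mod_cast hn
  have hd' : (0 : ℝ) < d := by exact_mod_cast hd
  have hl : 0 ≤ Real.log d := Real.log_natCast_nonneg d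
  refine (measureReal_sampleCov_sub_ge_le hn hK h0 h hX hind
    (by unfold rate; positivity) hu).trans ?_
  have h1 : (n : ℝ) * (expRate K ^ 2 * (160 * K ^ 2 * rate n d) ^ 2 / 64) =
      25 / Real.exp 1 ^ 2 * Real.log d := by
    rw [mul_pow _ (rate n d), rate, Real.sq_sqrt (by positivity), expRate]
    field_simp
    norm_num
    ring
  have h2 : 3 * Real.log d ≤ 25 / Real.exp 1 ^ 2 * Real.log d := by
    gcongr
    rw [le_div_iff₀ (by positivity)]
    nlinarith [Real.exp_one_lt_d9, Real.exp_pos 1]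
  rw [h1]
  have h3 : Real.exp (-(25 / Real.exp 1 ^ 2 * Real.log d)) ≤ ((d : ℝ) ^ 3)⁻¹ := by
    rw [← Real.exp_log (by positivity : (0 : ℝ) < ((d : ℝ) ^ 3)⁻¹)]
    refine Real.exp_le_exp.2 ?_
    rw [Real.log_inv, Real.log_pow]
    push_cast
    linarith
  calc _ ≤ 2 * (d : ℝ) ^ 2 * ((d : ℝ) ^ 3)⁻¹ := by gcongr
    _ = _ := by field_simp

lemma measureReal_exists_sq_ge_log_le (hn : 0 < n) (hd : 0 < d) (hK : 0 < K)
    (h : ∀ j, psiNorm 2 (fun x : Fin d → ℝ => x j) μ ≤ ENNReal.ofReal K)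
    (hX : ∀ i, HasLaw (X i) μ P) :
    P.real {ω | ∃ i j, 2 / expRate K * Real.log ((n : ℝ) * d) ≤ X i ω j ^ 2} ≤ 2 / n := by
  have ha := expRate_pos hK
  have hn' : (0 : ℝ) < n := by exact_mod_cast hn
  have hd' : (1 : ℝ) ≤ d := by exact_mod_cast hd
  refine (measureReal_exists_sq_ge_le hK h hX _).trans ?_
  have h1 : Real.exp (-(expRate K * (2 / expRate K * Real.log ((n : ℝ) * d)))) =
      (((n : ℝ) * d) ^ 2)⁻¹ := by
    rw [← Real.exp_log (by positivity : (0 : ℝ) < (((n : ℝ) * d) ^ 2)⁻¹), Real.log_inv,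
      Real.log_pow]
    congr 1
    push_cast
    field_simp
  rw [h1]
  calc 2 * ((n : ℝ) * d) * (((n : ℝ) * d) ^ 2)⁻¹ = 2 / n * (1 / d) := by field_simp
    _ ≤ 2 / n * 1 := by
        gcongr
        rw [div_le_one (by linarith)]
        exact hd'
    _ = 2 / n := mul_one _

lemma measureReal_abs_mean_bilin_sq_sub_ge_le [IsProbabilityMeasure P] (hn : 0 < n) (hK : 0 ≤ K)
    (h : ∀ j, psiNorm 2 (fun x : Fin d → ℝ => x j) μ ≤ ENNReal.ofReal K)
    (hX : ∀ i, HasLaw (X i) μ P) (hind : iIndepFun X P) {v b : Fin d → ℝ} {L ε : ℝ} (hL : 0 ≤ L)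
    (hv : l1 v ≤ L) (hb : l1 b ≤ L) (hε : 0 < ε) :
    P.real {ω | ε ≤ |(n : ℝ)⁻¹ * ∑ i, bilin v (outer (X i ω)) b ^ 2 -
      ∫ x, bilin v (outer x) b ^ 2 ∂μ|} ≤ (L * (K * √8)) ^ 8 / (n * ε ^ 2) := by
  obtain ⟨hi, h4⟩ := integral_bilin_pow_four_le hK h hL hv hb
  have hm := (measurable_bilin_outer v b).pow_const 2
  have hsq : MemLp (fun x : Fin d → ℝ => bilin v (outer x) b ^ 2) 2 μ := by
    rw [memLp_two_iff_integrable_sq hm.aestronglyMeasurable]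
    exact hi.congr (ae_of_all _ fun x => by ring)
  have hvar : variance (fun x : Fin d → ℝ => bilin v (outer x) b ^ 2) μ ≤
      (L * (K * √8)) ^ 8 := by
    refine (variance_le_expectation_sq hm.aestronglyMeasurable).trans (le_trans (le_of_eq ?_) h4)
    refine integral_congr_ae (ae_of_all _ fun x => ?_)
    simp only [Pi.pow_apply]
    ring
  refine measureReal_abs_mean_sub_ge_le_of_variance
    (Z := fun i ω => bilin v (outer (X i ω)) b ^ 2) hn ?_ ?_ ?_ ?_ hε
  · intro i
    rw [← (hX i).map_eq] at hsq
    exact hsq.comp_of_map (hX i).aemeasurable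
  · exact hind.comp (fun _ x => bilin v (outer x) b ^ 2) fun _ => hm
  · intro i
    exact (hX i).integral_comp hm.aestronglyMeasurable
  · intro i
    have h1 := variance_map (X := fun x : Fin d → ℝ => bilin v (outer x) b ^ 2) (μ := P) (Y := X i)
      (by rw [(hX i).map_eq]; exact hm.aemeasurable) (hX i).aemeasurable
    rw [(hX i).map_eq] at h1
    exact h1.symm.le.trans hvar

end SampleEvents

/-! ### Second moments of the bilinear form. -/

section BilinearForm

variable {d : ℕ} {μ : Measure (Fin d → ℝ)} [IsProbabilityMeasure μ] {K : ℝ}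

lemma integral_bilin_sq_le (hK : 0 ≤ K)
    (h : ∀ j, psiNorm 2 (fun x : Fin d → ℝ => x j) μ ≤ ENNReal.ofReal K) {v b : Fin d → ℝ} {L : ℝ}
    (hL : 0 ≤ L) (hv : l1 v ≤ L) (hb : l1 b ≤ L) :
    ∫ x, bilin v (outer x) b ^ 2 ∂μ ≤ 1 + (L * (K * √8)) ^ 8 := by
  obtain ⟨hi, h4⟩ := integral_bilin_pow_four_le hK h hL hv hb
  refine (integral_mono_of_nonneg (ae_of_all _ fun x => sq_nonneg _)
    ((integrable_const (1 : ℝ)).add hi) (ae_of_all _ fun x => ?_)).trans ?_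
  · change bilin v (outer x) b ^ 2 ≤ 1 + bilin v (outer x) b ^ 4
    nlinarith [sq_nonneg (bilin v (outer x) b ^ 2 - 1), sq_nonneg (bilin v (outer x) b)]
  · simp only [Pi.add_apply]
    rw [integral_add (integrable_const _) hi]
    simpa using h4

lemma popDelta_eq (hK : 0 ≤ K)
    (h : ∀ j, psiNorm 2 (fun x : Fin d → ℝ => x j) μ ≤ ENNReal.ofReal K) {v b : Fin d → ℝ} {L : ℝ}
    (hL : 0 ≤ L) (hv : l1 v ≤ L) (hb : l1 b ≤ L) :
    popDelta μ v b = ∫ x, bilin v (outer x) b ^ 2 ∂μ - (∫ x, bilin v (outer x) b ∂μ) ^ 2 := by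
  obtain ⟨hi, h4⟩ := integral_bilin_pow_four_le hK h hL hv hb
  have hm := memLp_four_of_integrable_pow (measurable_bilin_outer v b).aestronglyMeasurable hi
  rw [popDelta, variance_eq_sub (hm.mono_exponent (by norm_num))]
  rfl

end BilinearForm

end Clime

/-! ### Assembly of the limit theorem. -/

theorem mainTheorem5 :
    ∃ A : ℝ, 0 < A ∧
    ∀ (K δ L α : ℝ), 0 < K → 0 < δ → 0 < L → 0 < α →
    -- triangular array: for sample size `n`, dimension `d n`, target entry `(1, m n)`, law `μ n`
    ∀ (d : ℕ → ℕ) [∀ n, NeZero (d n)] (m : ∀ n, Fin (d n))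
      (μ : ∀ n, Measure (Fin (d n) → ℝ)) [∀ n, IsProbabilityMeasure (μ n)],
    -- `E X = 0`, `max_j ‖X_j‖_{ψ₂} ≤ K`, `λ_min(Σ_X) ≥ δ`
    (∀ n j, ∫ x, x j ∂(μ n) = 0) →
    (∀ n j, Clime.psiNorm 2 (fun x : Fin (d n) → ℝ => x j) (μ n) ≤ ENNReal.ofReal K) →
    (∀ n, ∀ κ ∈ spectrum ℝ (Clime.popCov (μ n)), δ ≤ κ) →
    ∀ (βs vs : ∀ n, Fin (d n) → ℝ),
    (∀ n, βs n = Clime.precisionCol (μ n) (m n)) →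
    (∀ n, vs n = Clime.precisionCol (μ n) 0) →
    (∀ n, Clime.l1 (βs n) ≤ L) →
    (∀ n, Clime.l1 (vs n) ≤ L) →
    -- `Δ ≥ α ‖β*‖₂² ‖v*‖₂²`
    (∀ n, α * Clime.l2 (βs n) ^ 2 * Clime.l2 (vs n) ^ 2 ≤ Clime.popDelta (μ n) (vs n) (βs n)) →
    -- rate conditions
    ((fun n : ℕ => max ((Clime.l0 (vs n) : ℝ) ^ 2) ((Clime.l0 (βs n) : ℝ) ^ 2)
        * Real.log (d n) * Real.log ((n : ℝ) * d n) / n) =o[atTop] fun _ => (1 : ℝ)) →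
    (∃ k : ℝ, 2 < k ∧
      (fun n : ℕ => ((Clime.l0 (vs n) : ℝ) * Clime.l0 (βs n)) ^ k / (n : ℝ) ^ (k - 1))
        =o[atTop] fun _ => (1 : ℝ)) →
    -- moment conditions
    ((fun n : ℕ => variance
        (fun x : Fin (d n) → ℝ => Clime.bilin (vs n) (Clime.outer x) (βs n) ^ 2) (μ n))
        =o[atTop] fun n : ℕ => (n : ℝ)) →
    ((fun n : ℕ => ∫ x, Clime.bilin (vs n) (Clime.outer x) (βs n) ^ 2 ∂(μ n))
        =O[atTop] fun _ => (1 : ℝ)) →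
    -- tuning parameters
    ∀ (lam lam' : ℕ → ℝ),
    (lam =Θ[atTop] fun n => Clime.rate n (d n)) →
    (lam' =Θ[atTop] fun n => Clime.rate n (d n)) →
    (∀ᶠ n in atTop, A * K ^ 2 * Clime.l1 (βs n) * Clime.rate n (d n) ≤ lam n) →
    (∀ᶠ n in atTop, A * K ^ 2 * Clime.l1 (vs n) * Clime.rate n (d n) ≤ lam' n) →
    -- the i.i.d. sample `X_1, …, X_n` and the estimators built from it
    ∀ (Ω : ℕ → Type*) [∀ n, MeasurableSpace (Ω n)]
      (P : ∀ n, Measure (Ω n)) [∀ n, IsProbabilityMeasure (P n)]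
      (X : ∀ n, Fin n → Ω n → (Fin (d n) → ℝ)),
    (∀ n i, HasLaw (X n i) (μ n) (P n)) →
    (∀ n, iIndepFun (X n) (P n)) →
    ∀ (βhat vhat : ∀ n, Ω n → (Fin (d n) → ℝ)),
    (∀ n, AEMeasurable (βhat n) (P n)) →
    (∀ n, AEMeasurable (vhat n) (P n)) →
    (∀ n, ∀ᵐ ω ∂(P n), Clime.IsL1Solution
      (Clime.betaFeasible (fun i => X n i ω) (m n) (lam n)) (βhat n ω)) →
    (∀ n, ∀ᵐ ω ∂(P n), Clime.IsL1Solution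
      (Clime.vFeasible (fun i => X n i ω) (lam' n)) (vhat n ω)) →
    ∀ t : ℝ, Tendsto
      (fun n => |(P n).real {ω | Clime.studentized (fun i => X n i ω) (m n) (vhat n ω) (βhat n ω)
          (Clime.precision (μ n) 0 (m n)) ≤ t} - cdf (gaussianReal 0 1) t|)
      atTop (𝓝 0) := by
  refine ⟨160, by norm_num, ?_⟩
  intro K δ L α hK hδ hL hα d _ m μ _ h0 hψ hspec βs vs hβ hv hβL hvL hΔ hrate _ _ _ lam lam'
    hlamΘ hlamΘ' hlamA hlamA' Ω _ P _ X hX hind βhat vhat _ _ hβsol hvsol t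
  have hd : ∀ n, 1 ≤ d n := fun n => Nat.one_le_iff_ne_zero.2 (NeZero.ne _)
  have hS := fun n => Clime.mul_sum_sq_le_of_spectrum (hspec n)
  have hSb : ∀ n, Clime.popCov (μ n) *ᵥ βs n = Clime.unitVec (m n) := fun n =>
    hβ n ▸ Clime.popCov_mulVec_precisionCol hδ (hS n) (m n)
  have hSv : ∀ n, Clime.popCov (μ n) *ᵥ vs n = Clime.unitVec 0 := fun n =>
    hv n ▸ Clime.popCov_mulVec_precisionCol hδ (hS n) 0
  have hvm : ∀ n, vs n (m n) = βs n 0 := fun n => by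
    rw [hβ, hv]; exact Clime.precision_comm _ _
  have hθ : ∀ n, Clime.precision (μ n) 0 (m n) = βs n 0 := fun n => by rw [hβ]; rfl
  have hmean : ∀ n, ∫ x, Clime.bilin (vs n) (Clime.outer x) (βs n) ∂(μ n) = βs n 0 := fun n => by
    rw [Clime.integral_bilin_outer hK.le (h0 n) (hψ n), hSb, Clime.dotProduct_unitVec, hvm]
  have hdelta : ∀ n, Clime.popDelta (μ n) (vs n) (βs n) =
      ∫ x, Clime.bilin (vs n) (Clime.outer x) (βs n) ^ 2 ∂(μ n) - βs n 0 ^ 2 := fun n => by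
    rw [Clime.popDelta_eq hK.le (hψ n) hL.le (hvL n) (hβL n), hmean]
  set C₄ := (L * (K * √8)) ^ 8
  have hC₄ : 0 ≤ C₄ := by positivity
  -- A floor for Δ: the entries β*_m and v*_1 lie on the diagonal of Ω*, so each is at least
  -- 1/(2K²).
  set D₀ := α * ((2 * K ^ 2)⁻¹) ^ 2 * ((2 * K ^ 2)⁻¹) ^ 2
  have hD₀ : 0 < D₀ := by positivity
  have hl2 : ∀ n (b : Fin (d n) → ℝ) j, Clime.popCov (μ n) *ᵥ b = Clime.unitVec j →
      ((2 * K ^ 2)⁻¹) ^ 2 ≤ Clime.l2 b ^ 2 := fun n b j hb => by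
    refine le_trans ?_ (Clime.sq_le_l2_sq b j)
    have := Clime.inv_le_of_mulVec_eq hδ (hS n) (by positivity) hb
      (Clime.popCov_diag_le hK.le (h0 n) (hψ n) j)
    gcongr
  have hD : ∀ n, D₀ ≤ Clime.popDelta (μ n) (vs n) (βs n) := fun n => by
    refine le_trans ?_ (hΔ n)
    have h1 := hl2 n _ _ (hSb n)
    have h2 := hl2 n _ _ (hSv n)
    exact mul_le_mul (mul_le_mul_of_nonneg_left h1 hα.le) h2 (by positivity) (by positivity)
  -- the central limit theorem for the leading term
  set z : ∀ n, (Fin (d n) → ℝ) → ℝ := fun n x =>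
    -(Clime.bilin (vs n) (Clime.outer x) (βs n) - βs n 0) /
      √(Clime.popDelta (μ n) (vs n) (βs n)) with hz
  have hzm : ∀ n, Measurable (z n) := fun n =>
    ((Clime.measurable_bilin_outer _ _).sub_const _).neg.div_const _
  have hstd := fun n => Clime.standardized_moments (Clime.measurable_bilin_outer (vs n) (βs n))
    (Clime.integral_bilin_pow_four_le hK.le (hψ n) hL.le (hvL n) (hβL n)).1
    (Clime.integral_bilin_pow_four_le hK.le (hψ n) hL.le (hvL n) (hβL n)).2 (hmean n)
    ((Clime.abs_le_l1 (βs n) 0).trans (hβL n)) hD₀ (hD n)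
  have hprob : ∀ n, IsProbabilityMeasure ((μ n).map (z n)) := fun n =>
    Measure.isProbabilityMeasure_map (hzm n).aemeasurable
  have hW := Clime.tendsto_measureReal_sum_le (P := P) (ν := fun n => (μ n).map (z n))
    (Z := fun n i ω => z n (X n i ω)) (C := 8 * (C₄ + L ^ 4) / D₀ ^ 2)
    (fun n i => (HasLaw.mk (hzm n).aemeasurable rfl).comp (hX n i))
    (fun n => (hind n).comp (fun _ => z n) fun _ => hzm n)
    (fun n => by
      rw [integrable_map_measure (by fun_prop) (hzm n).aemeasurable]
      exact (hstd n).2.2.1)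
    (fun n => by
      rw [integral_map (hzm n).aemeasurable (by fun_prop)]
      exact (hstd n).1)
    (fun n => by
      rw [integral_map (hzm n).aemeasurable (by fun_prop)]
      exact (hstd n).2.1)
    (fun n => by
      rw [integral_map (hzm n).aemeasurable (by fun_prop)]
      exact (hstd n).2.2.2)
  -- rates
  set σ : ℕ → ℝ := fun n => max (Clime.l0 (vs n) : ℝ) (Clime.l0 (βs n))
  have hσv : ∀ n, (Clime.l0 (vs n) : ℝ) ≤ σ n := fun n => le_max_left _ _
  have hσb : ∀ n, (Clime.l0 (βs n) : ℝ) ≤ σ n := fun n => le_max_right _ _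
  have hσ1 : ∀ n, 1 ≤ σ n := fun n =>
    le_trans (by exact_mod_cast Clime.one_le_l0_of_mulVec_eq (hSv n)) (hσv n)
  have hσd : ∀ n, σ n ≤ d n := fun n =>
    max_le (by exact_mod_cast Clime.l0_le _) (by exact_mod_cast Clime.l0_le _)
  have hσsq : ∀ n, max ((Clime.l0 (vs n) : ℝ) ^ 2) ((Clime.l0 (βs n) : ℝ) ^ 2) = σ n ^ 2 := by
    intro n
    rcases le_total (Clime.l0 (vs n) : ℝ) (Clime.l0 (βs n)) with h | h
    · simp only [σ]
      rw [max_eq_right h, max_eq_right (by gcongr)]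
    · simp only [σ]
      rw [max_eq_left h, max_eq_left (by gcongr)]
  simp only [hσsq] at hrate
  obtain ⟨hg, hσg, hng, hBg⟩ := Clime.tendsto_rates hd hσ1
    (Clime.tendsto_slow_of_tendsto hd hσd hσ1 ((isLittleO_one_iff ℝ).1 hrate))
  obtain ⟨Ca, hCa0, hCa⟩ := hlamΘ.1.exists_pos
  obtain ⟨Cb, hCb0, hCb⟩ := hlamΘ'.1.exists_pos
  set C₁ := max Ca Cb
  have hC₁ : 0 < C₁ := lt_max_of_lt_left hCa0
  have ha := Clime.expRate_pos hK
  set a := Clime.expRate K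
  have hmain := Clime.tendsto_measureReal_le_of_slutsky (P := P)
    (U := fun n ω => Clime.studentized (fun i => X n i ω) (m n) (vhat n ω) (βhat n ω)
          (Clime.precision (μ n) 0 (m n))) Clime.continuous_cdf_gaussianReal hW ?_ t
  · simpa using (hmain.sub_const (cdf (gaussianReal 0 1) t)).abs
  intro η hη ε hε
  obtain ⟨p, hp2, hpε⟩ : ∃ p : ℝ, 2 ≤ p ∧ 2 * Real.exp (-p) ≤ ε / 4 := by
    have h1 : Tendsto (fun p : ℝ => 2 * Real.exp (-p)) atTop (𝓝 0) := by
      simpa using Real.tendsto_exp_neg_atTop_nhds_zero.const_mul 2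
    exact ((eventually_ge_atTop 2).and (h1.eventually_le_const (by positivity))).exists
  obtain ⟨D, hD1, hDε⟩ : ∃ D : ℕ, 1 ≤ D ∧ 2 / (D : ℝ) ≤ ε / 4 :=
    ((eventually_ge_atTop 1).and
      ((tendsto_const_div_atTop_nhds_zero_nat (2 : ℝ)).eventually_le_const
        (by positivity))).exists
  -- Half of the admissible variance error: `varianceError` tends to ε₀, so it is eventually below
  -- the full amount.
  set ε₀ := min (1 / 2) (η / 4) * D₀ / 2
  have hmin : 0 < min (1 / 2) (η / 4) := lt_min (by norm_num) (by positivity)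
  have hε₀ : 0 < ε₀ := by positivity
  have hε₀' : ε₀ < min (1 / 2) (η / 4) * D₀ := by
    have : 0 < min (1 / 2) (η / 4) * D₀ := by positivity
    simp only [ε₀]; linarith
  set M := 8 * √p / a
  have hM : 0 ≤ M := by positivity
  set g : ℕ → ℝ := fun n => Clime.slowRate n (d n)
  have hg0 : ∀ n, 0 ≤ g n := fun n => Real.sqrt_nonneg _
  -- Chosen so that `e n` is exactly the bound of `l1_error_le_of_good` with τ = M g and λ-bound C₁
  -- g.
  set C₂ := 8 * D * (C₁ + M * L) / δ
  set e : ℕ → ℝ := fun n => C₂ * (σ n * g n)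
  have hC₂ : 0 ≤ C₂ := by positivity
  have he0 : ∀ n, 0 ≤ e n := fun n =>
    mul_nonneg hC₂ (mul_nonneg (zero_le_one.trans (hσ1 n)) (hg0 n))
  set B : ℕ → ℝ := fun n => 2 / a * Real.log ((n : ℝ) * d n)
  have hB0 : ∀ n, 0 ≤ B n := fun n => mul_nonneg (by positivity) (by
    rw [← Nat.cast_mul]; exact Real.log_natCast_nonneg _)
  have tτ : Tendsto (fun n => M * g n) atTop (𝓝 0) := by simpa using hg.const_mul M
  have tlam : Tendsto (fun n => C₁ * g n) atTop (𝓝 0) := by simpa using hg.const_mul C₁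
  have te : Tendsto e atTop (𝓝 0) := by simpa using hσg.const_mul C₂
  have tρ : Tendsto (fun n => M * g n * L) atTop (𝓝 0) := by simpa using tτ.mul_const L
  have tu : Tendsto (fun n => 160 * K ^ 2 * g n) atTop (𝓝 0) := by
    simpa using hg.const_mul (160 * K ^ 2)
  have tsm : Tendsto (fun n => 8 * (D * σ n) * (M * g n)) atTop (𝓝 0) := by
    have := hσg.const_mul (8 * D * M)
    rw [mul_zero] at this
    exact this.congr fun n => by ring
  have tB : Tendsto (fun n => e n ^ 2 * B n) atTop (𝓝 0) := by
    have := hBg.const_mul (C₂ ^ 2 * (2 / a))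
    rw [mul_zero] at this
    exact this.congr fun n => by simp only [e, B, g]; ring
  have trem : Tendsto (fun n : ℕ => √(n : ℝ) * (2 * (C₁ * g n) * e n + e n * (M * g n * L)))
      atTop (𝓝 0) := by
    have := hng.const_mul (C₂ * (2 * C₁ + M * L))
    rw [mul_zero] at this
    exact this.congr fun n => by simp only [e, g]; ring
  have tvar := Clime.tendsto_varianceError L (1 + C₄) ε₀ te tlam tB
  have tE2 : Tendsto (fun n : ℕ => 2 / (n : ℝ)) atTop (𝓝 0) :=
    tendsto_const_div_atTop_nhds_zero_nat 2
  have tE3 : Tendsto (fun n : ℕ => C₄ / (n * ε₀ ^ 2)) atTop (𝓝 0) := by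
    refine (tendsto_const_div_atTop_nhds_zero_nat (C₄ / ε₀ ^ 2)).congr fun n => ?_
    rw [div_div, mul_comm]
  have h16 : 0 < 16 / a := by positivity
  filter_upwards [eventually_gt_atTop 0, hCa.bound, hCb.bound, hlamA, hlamA',
    tτ.eventually_le_const h16, tu.eventually_le_const h16,
    tlam.eventually_lt_const zero_lt_one, tlam.eventually_le_const (by positivity : 0 < η / 4),
    te.eventually_le_const zero_lt_one, tρ.eventually_le_const zero_lt_one,
    tsm.eventually_le_const hδ, tvar.eventually_le_const hε₀',
    trem.eventually_le_const (by positivity : 0 < η * √D₀),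
    tE2.eventually_le_const (by positivity : 0 < ε / 4),
    tE3.eventually_le_const (by positivity : 0 < ε / 4)]
    with n hn nCa nCb nlam nlam' nτ nu nlam1 nlamη ne1 nρ nsm nvar nrem nE2 nE3
  have hrg := Clime.rate_le_slowRate n (d n)
  have hr0 : 0 ≤ Clime.rate n (d n) := Real.sqrt_nonneg _
  have hlamB : ∀ (l C : ℝ), C ≤ C₁ → ‖l‖ ≤ C * ‖Clime.rate n (d n)‖ → l ≤ C₁ * g n := by
    intro l C hC hl
    rw [Real.norm_of_nonneg hr0] at hl
    exact (le_abs_self l).trans (hl.trans (mul_le_mul hC hrg hr0 hC₁.le))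
  have hu0 : 0 ≤ 160 * K ^ 2 * Clime.rate n (d n) := by positivity
  have hu16 : 160 * K ^ 2 * Clime.rate n (d n) ≤ 16 / a := le_trans (by gcongr) nu
  set E1 := {ω | ∃ j k, M * g n ≤
    |Clime.sampleCov (fun i => X n i ω) j k - Clime.popCov (μ n) j k|}
  set E2 := {ω | ∃ i j, B n ≤ X n i ω j ^ 2}
  set E3 := {ω | ε₀ ≤ |(n : ℝ)⁻¹ * ∑ i, Clime.bilin (vs n) (Clime.outer (X n i ω)) (βs n) ^ 2 -
      ∫ x, Clime.bilin (vs n) (Clime.outer x) (βs n) ^ 2 ∂(μ n)|}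
  -- Including D < d n empties the event in low dimension, where its probability bound 2/d would be
  -- useless.
  set E4 := {ω | D < d n ∧ ∃ j k, 160 * K ^ 2 * Clime.rate n (d n) ≤
    |Clime.sampleCov (fun i => X n i ω) j k - Clime.popCov (μ n) j k|}
  set N := {ω | ¬ (Clime.IsL1Solution
      (Clime.betaFeasible (fun i => X n i ω) (m n) (lam n)) (βhat n ω) ∧
      Clime.IsL1Solution (Clime.vFeasible (fun i => X n i ω) (lam' n)) (vhat n ω))}
  have p1 : (P n).real E1 ≤ ε / 4 :=
    (Clime.measureReal_sampleCov_sub_ge_slowRate_le hn (hd n) hK (h0 n) (hψ n) (hX n) (hind n) hp2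
      nτ).trans hpε
  have p2 : (P n).real E2 ≤ ε / 4 :=
    (Clime.measureReal_exists_sq_ge_log_le hn (hd n) hK (hψ n) (hX n)).trans nE2
  have p3 : (P n).real E3 ≤ ε / 4 :=
    (Clime.measureReal_abs_mean_bilin_sq_sub_ge_le hn hK.le (hψ n) (hX n) (hind n) hL.le (hvL n)
      (hβL n) hε₀).trans nE3
  have p4 : (P n).real E4 ≤ ε / 4 := by
    by_cases hDd : D < d n
    · refine (measureReal_mono fun ω hω => hω.2).trans
        ((Clime.measureReal_sampleCov_sub_ge_rate_le hn (hd n) hK (h0 n) (hψ n) (hX n) (hind n)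
          hu16).trans (le_trans ?_ hDε))
      gcongr
    · have : E4 = ∅ := by ext ω; simp [E4, hDd]
      rw [this, measureReal_empty]
      positivity
  have p5 : (P n).real N = 0 := by
    rw [measureReal_def, ENNReal.toReal_eq_zero_iff]
    exact Or.inl (ae_iff.1 ((hβsol n).and (hvsol n)))
  have hsub : {ω | ¬ ∃ q r : ℝ, |q - 1| ≤ η ∧ |r| ≤ η ∧
      (√(n : ℝ))⁻¹ * ∑ i, z n (X n i ω) + r = q * Clime.studentized (fun i => X n i ω) (m n)
        (vhat n ω) (βhat n ω) (Clime.precision (μ n) 0 (m n))} ⊆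
      E1 ∪ E2 ∪ E3 ∪ E4 ∪ N := by
    intro ω hω
    by_contra hgood
    simp only [Set.mem_union, not_or] at hgood
    obtain ⟨⟨⟨⟨g1, g2⟩, g3⟩, g4⟩, g5⟩ := hgood
    apply hω
    have f1 : ∀ j k, |(Clime.sampleCov (fun i => X n i ω) - Clime.popCov (μ n)) j k| ≤
        M * g n := fun j k => (lt_of_not_ge fun h => g1 ⟨j, k, h⟩).le
    have f2 : ∀ i j, X n i ω j ^ 2 ≤ B n := fun i j => (lt_of_not_ge fun h => g2 ⟨i, j, h⟩).le
    have f3 : |(n : ℝ)⁻¹ * ∑ i, Clime.bilin (vs n) (Clime.outer (X n i ω)) (βs n) ^ 2 -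
        ∫ x, Clime.bilin (vs n) (Clime.outer x) (βs n) ^ 2 ∂(μ n)| ≤ ε₀ :=
      (lt_of_not_ge fun h => g3 h).le
    have f4 : D < d n → ∀ j k,
        |(Clime.sampleCov (fun i => X n i ω) - Clime.popCov (μ n)) j k| ≤
        160 * K ^ 2 * Clime.rate n (d n) :=
      fun hDd j k => (lt_of_not_ge fun h => g4 ⟨hDd, j, k, h⟩).le
    obtain ⟨f5, f6⟩ := not_not.1 g5
    rw [Clime.vFeasible_eq] at f6
    have hτ0 : 0 ≤ M * g n := mul_nonneg hM (hg0 n)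
    have hee : 8 * (D * σ n) * (C₁ * g n + M * g n * L) / δ = e n := by
      simp only [e, C₂]; ring
    obtain ⟨b1, b2⟩ := Clime.l1_error_le_of_good hδ hτ0 hu0 hD1 (hσ1 n) (hS n) f1 f4 (hSb n)
      hL.le (hβL n) (hσb n) (by linarith) (hlamB _ _ (le_max_left _ _) nCa) f5 nsm
    obtain ⟨v1, v2⟩ := Clime.l1_error_le_of_good hδ hτ0 hu0 hD1 (hσ1 n) (hS n) f1 f4 (hSv n)
      hL.le (hvL n) (hσv n) (by linarith) (hlamB _ _ (le_max_right _ _) nCb) f6 nsm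
    rw [hee] at b2 v2
    have hres : ∀ (b : Fin (d n) → ℝ) j, Clime.popCov (μ n) *ᵥ b = Clime.unitVec j →
        Clime.l1 b ≤ L →
        ‖Clime.sampleCov (fun i => X n i ω) *ᵥ b - Clime.unitVec j‖ ≤ M * g n * L := by
      intro b j hb hbL
      rw [← hb, ← sub_mulVec]
      exact (Clime.norm_mulVec_le hτ0 f1 b).trans (by gcongr)
    have hdec := Clime.exists_studentized_decomposition hn hη hD₀ nlam1 (he0 n) ne1 hL.le nρ
      (hB0 n) (hβL n) (hvL n) (hvm n) b1 v1 (hres _ _ (hSb n) (hβL n)) (hres _ _ (hSv n) (hvL n))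
      v2 b2 f2 (Clime.integral_bilin_sq_le hK.le (hψ n) hL.le (hvL n) (hβL n))
      (by rw [← hdelta]; exact hD n) f3 nlamη nvar nrem
    rw [hθ]
    simp only [hz, hdelta]
    exact hdec
  calc _ ≤ _ := measureReal_mono hsub
    _ ≤ (P n).real E1 + (P n).real E2 + (P n).real E3 + (P n).real E4 + (P n).real N :=
        (measureReal_union_le _ _).trans (add_le_add_left ((measureReal_union_le _ _).trans
          (add_le_add_left ((measureReal_union_le _ _).trans (add_le_add_left
            (measureReal_union_le _ _) _)) _)) _)
    _ ≤ ε := by linarith
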